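/- Let $M$ be an oriented smooth manifold (Hausdorff, $\sigma$-compact, without boundary) of dimension $n$. For $k\in\mathbb R$ let $L^k=GL(M)\times_{|\det|^{k/n}}\mathbb R$ be the line bundle of densities of weight $k$; the sections of $L^{-n}$ are the densities that can be integrated over $M$. A conformal structure on $M$ is a smooth, positive definite section $c$ of $L^2\otimes S^2T^*M$, normalized by $\det\big(c(b_i,b_j)\big)=1$ in the trivialization of $L$ given by any frame $b$. A Weyl connection on $(M,c)$ is a smooth torsion-free connection $D$ on $TM$ with $Dc=0$, where $D$ also acts on the bundles $L^k$ associated with the frame bundle. Put $R^D_{X,Y}Z=D_XD_YZ-D_YD_XZ-D_{[X,Y]}Z$ and $\mathrm{Ric}^D(X,Y)=\mathrm{trace}(Z\mapsto R^D_{Z,X}Y)$. For a $1$-form $\omega$ of weight $k$ (a smooth section of $L^k\otimes T^*M$) put $\delta^D\omega=-\mathrm{tr}_c(D\omega)$, a section of $L^{k-2}$; $(d^D\omega)(X,Y)=(D_X\omega)(Y)-(D_Y\omega)(X)$, a $2$-form of weight $k$; and $\mathscr D^D\omega=\delta^D\omega+d^D\omega$. All inner products $\langle\ ,\ \rangle$,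 with $|\cdot|^2=\langle\cdot,\cdot\rangle$, and the isomorphisms $\sharp$, $\flat$ are those induced by $c$; a contraction with $c^{-1}$ lowers the weight by $2$. On $2$-forms, the $e_i^*\wedge e_j^*$ with $i<j$ are orthonormal when $(e_i)$ is $c$-orthonormal, and forms of different degrees are orthogonal. Let $\Omega\subset M$ be compact, let $D$ be a Weyl connection on $(M,c)$, and let $\alpha$ be a $1$-form of weight $k=(4-n)/2$. Then $$\zeta_\alpha(X)=\langle\alpha,\ D_X\alpha+\delta^D(\alpha)X^\flat-X\lrcorner d^D\alpha\rangle$$ is a $1$-form of weight $2k-2=2-n$, both $|D\alpha|^2+\mathrm{Ric}^D(\alpha^\sharp,\alpha^\sharp)-|\mathscr D^D\alpha|^2$ and $\delta^D(\zeta_\alpha)$ are densities of weight $-n$, integrable on $\Omega$, and $$\int_\Omega\Big(|D\alpha|^2+\mathrm{Ric}^D(\alpha^\sharp,\alpha^\sharp)-|\mathscr D^D\alpha|^2\Big)=-\int_\Omega\delta^D(\zeta_\alpha).$$ -/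

import Mathlib

open Set Bundle Module MeasureTheory
open scoped Manifold ContDiff Topology

noncomputable section

namespace ConformalWeyl

/-- The tangent space at `x` of the `n`-dimensional (boundaryless) manifold `M`. -/
abbrev Tan (n : ℕ) {M : Type*} [TopologicalSpace M] [ChartedSpace (EuclideanSpace ℝ (Fin n)) M]
    (x : M) : Type :=
  TangentSpace (𝓡 n) x

/-- Frames of `M` at `x`, that is, bases of `T_x M`: the fibre of the frame bundle `GL(M)`. -/
abbrev Frame (n : ℕ) {M : Type*} [TopologicalSpace M] [ChartedSpace (EuclideanSpace ℝ (Fin n)) M]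
    (x : M) : Type :=
  Basis (Fin n) ℝ (TangentSpace (𝓡 n) x)

section Fields

variable {n : ℕ} {M : Type*} [TopologicalSpace M] [ChartedSpace (EuclideanSpace ℝ (Fin n)) M]

/-- Let `L^k = GL(M) ×_{|det|^{k/n}} ℝ` be the line bundle of densities of weight `k`. A section
of `L^k ⊗ V` is a map `s` that sends a frame `b` at `x` to an element of `V x` and satisfies
`s (b A) = |det A|^{-k/n} s (b)` for all `A ∈ GL_n(ℝ)`. Here `A` is the matrix of the frame `b'`
in the frame `b`, and `b.det b'` is its determinant. For `k = - n` this is the transformation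
rule of the densities that can be integrated. -/
def HasWeight {V : M → Type*} [∀ x, AddCommGroup (V x)] [∀ x, Module ℝ (V x)] (k : ℝ)
    (s : ∀ x : M, Frame n x → V x) : Prop :=
  ∀ (x : M) (b b' : Frame n x), s x b' = (|b.det b'| ^ (-k / (n : ℝ))) • s x b

/-- Smoothness of a vector field on a subset `U` of `M`. -/
def IsSmoothFieldOn [IsManifold (𝓡 n) ∞ M] (X : ∀ y : M, Tan n y) (U : Set M) : Prop :=
  ContMDiffOn (𝓡 n) (𝓡 n).tangent ∞ (fun y ↦ (⟨y, X y⟩ : TangentBundle (𝓡 n) M)) U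

/-- A choice of a frame at each point of `M` which is a smooth moving frame on `U` (nothing is
asked of it outside `U`). -/
def IsSmoothFrameOn [IsManifold (𝓡 n) ∞ M] (e : ∀ y : M, Frame n y) (U : Set M) : Prop :=
  ∀ i, IsSmoothFieldOn (fun y ↦ e y i) U

variable (n M) in
/-- A `1`-form of weight `k`: a smooth section of `L^k ⊗ T*M`. Smoothness means that, on each open
set, the evaluation in a smooth moving frame on a smooth vector field is a smooth function. -/
structure WeightedOneForm [IsManifold (𝓡 n) ∞ M] (k : ℝ) where
  /-- The value of the form in a frame. -/
  toFun : ∀ x : M, Frame n x → (Tan n x →ₗ[ℝ] ℝ)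
  weight : HasWeight k toFun
  smooth : ∀ (U : Set M), IsOpen U → ∀ e : (∀ y : M, Frame n y), IsSmoothFrameOn e U →
    ∀ X : (∀ y : M, Tan n y), IsSmoothFieldOn X U →
      ContMDiffOn (𝓡 n) 𝓘(ℝ, ℝ) ∞ (fun y ↦ toFun y (e y) (X y)) U

variable (n M) in
/-- A conformal structure on `M`: a smooth section `c` of `L^2 ⊗ S^2 T*M`, positive definite and
normalized. For a frame `b` at `x`, `c x b` is the inner product of the conformal class for which
the parallelepiped spanned by `b` has volume one; this is the normalization. -/
structure ConformalStructure [IsManifold (𝓡 n) ∞ M] where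
  /-- The value of `c` in a frame. -/
  toFun : ∀ x : M, Frame n x → (Tan n x →ₗ[ℝ] Tan n x →ₗ[ℝ] ℝ)
  weight : HasWeight 2 toFun
  symm : ∀ x b v w, toFun x b v w = toFun x b w v
  pos : ∀ x b v, v ≠ 0 → 0 < toFun x b v v
  normalized : ∀ x b, (Matrix.of fun i j ↦ toFun x b (b i) (b j)).det = 1
  smooth : ∀ (U : Set M), IsOpen U → ∀ e : (∀ y : M, Frame n y), IsSmoothFrameOn e U →
    ∀ X Y : (∀ y : M, Tan n y), IsSmoothFieldOn X U → IsSmoothFieldOn Y U →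
      ContMDiffOn (𝓡 n) 𝓘(ℝ, ℝ) ∞ (fun y ↦ toFun y (e y) (X y) (Y y)) U

/-! ### Connections on weighted tensors -/

section Connection

variable [IsManifold (𝓡 n) ∞ M]

open Classical in
/-- A moving frame that extends the frame `b` at `x`: near `x` its members are the standard local
extensions `FiberBundle.extend` of the vectors `b i`; at the points where these do not form a
basis an arbitrary frame is taken. -/
def extendFrame {x : M} (b : Frame n x) (y : M) : Frame n y :=
  if h : LinearIndependent ℝ
      (fun i ↦ (FiberBundle.extend (EuclideanSpace ℝ (Fin n)) (b i) y : Tan n y)) ∧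
      ⊤ ≤ Submodule.span ℝ (Set.range
        (fun i ↦ (FiberBundle.extend (EuclideanSpace ℝ (Fin n)) (b i) y : Tan n y)))
  then Basis.mk h.1 h.2
  else ((EuclideanSpace.basisFun (Fin n) ℝ).toBasis :
    Basis (Fin n) ℝ (EuclideanSpace ℝ (Fin n)))

variable (D : CovariantDerivative (𝓡 n) (EuclideanSpace ℝ (Fin n)) (Tan n : M → Type))

/-- `D e_j` at `x`, as the linear map `v ↦ D_v e_j`, for the moving frame `e` extending `b`. -/
def covFrame (x : M) (b : Frame n x) (j : Fin n) : Tan n x →ₗ[ℝ] Tan n x :=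
  (D (fun y ↦ extendFrame b y j) x).toLinearMap

/-- The trace `v ↦ ∑ i, e^i (D_v e_i)` of the connection form of `D` in the moving frame `e`
extending `b`. The connection induced by `D` on `L^k` has the connection form `k / n` times this
trace, in the trivialization of `L^k` given by `e`. -/
def connTrace (x : M) (b : Frame n x) : Tan n x →ₗ[ℝ] ℝ :=
  ∑ i, b.coord i ∘ₗ covFrame D x b i

/-- The covariant derivative `D α` of a `1`-form `α` of weight `k`, as the bilinear form
`(v, w) ↦ (D_v α)(w)`, in the frame `b`. With `e` a moving frame extending `b`,
`(D_v α)(e_j) = v (α(e_j)) + (k/n) (∑ i, e^i (D_v e_i)) α(e_j) - α (D_v e_j)`,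
where `α` is trivialized by `e`. -/
def covForm (k : ℝ) (α : ∀ x : M, Frame n x → (Tan n x →ₗ[ℝ] ℝ)) (x : M) (b : Frame n x) :
    Tan n x →ₗ[ℝ] Tan n x →ₗ[ℝ] ℝ :=
  LinearMap.flip <| b.constr ℝ fun j ↦
    (mvfderiv (𝓡 n) (fun y ↦ α y (extendFrame b y) (extendFrame b y j)) x).toLinearMap
      + (k / (n : ℝ) * α x b (b j)) • connTrace D x b
      - α x b ∘ₗ covFrame D x b j

/-- The components `v ↦ (D_v q)(e_i, e_j)` of the covariant derivative of a section `q` of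
`L^k ⊗ T*M ⊗ T*M`, in the frame `b`, with `e` a moving frame extending `b`. -/
def covBilin (k : ℝ) (q : ∀ x : M, Frame n x → (Tan n x →ₗ[ℝ] Tan n x →ₗ[ℝ] ℝ))
    (x : M) (b : Frame n x) (i j : Fin n) : Tan n x →ₗ[ℝ] ℝ :=
  (mvfderiv (𝓡 n)
      (fun y ↦ q y (extendFrame b y) (extendFrame b y i) (extendFrame b y j)) x).toLinearMap
    + (k / (n : ℝ) * q x b (b i) (b j)) • connTrace D x b
    - (q x b).flip (b j) ∘ₗ covFrame D x b i
    - q x b (b i) ∘ₗ covFrame D x b j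

/-- The curvature `R_{u,v} w = D_u D_v w - D_v D_u w - D_{[u,v]} w` of `D` at `x`, computed by
extending `u`, `v`, `w` to vector fields that are smooth near `x`. -/
def curvature (x : M) (u v w : Tan n x) : Tan n x :=
  let U : ∀ y : M, Tan n y := FiberBundle.extend (EuclideanSpace ℝ (Fin n)) u
  let V : ∀ y : M, Tan n y := FiberBundle.extend (EuclideanSpace ℝ (Fin n)) v
  let W : ∀ y : M, Tan n y := FiberBundle.extend (EuclideanSpace ℝ (Fin n)) w
  D (fun y ↦ D W y (V y)) x u - D (fun y ↦ D W y (U y)) x v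
    - D W x (VectorField.mlieBracket (𝓡 n) U V x)

/-- The Ricci curvature `Ric(v, w) = trace (z ↦ R_{z,v} w)`, the trace being computed in the
basis `b`. -/
def ricci (x : M) (b : Frame n x) (v w : Tan n x) : ℝ :=
  ∑ i, b.coord i (curvature D x (b i) v w)

end Connection

/-- A Weyl connection on the conformal manifold `(M, c)`: a smooth torsion-free connection on `TM`
that preserves the conformal structure, `D c = 0`, where `D` acts on `TM` and on `L`. -/
structure WeylConnection [IsManifold (𝓡 n) ∞ M] (c : ConformalStructure n M) where
  /-- The connection on the tangent bundle. -/
  conn : CovariantDerivative (𝓡 n) (EuclideanSpace ℝ (Fin n)) (Tan n : M → Type)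
  smooth : CovariantDerivative.ContMDiffCovariantDerivative conn ∞
  torsionFree : conn.torsion = 0
  parallel : ∀ (x : M) (b : Frame n x) (i j : Fin n), covBilin conn 2 c.toFun x b i j = 0

/-! ### Conformal contractions

In a frame `b` at `x` every contraction is the usual one for the inner product `c x b`; since `c`
has weight `2`, each contraction with `c⁻¹` lowers the weight by `2`. If `b` is `c`-orthonormal,
the section `l` of `L` associated with `b` is `1` in the trivialization given by `b`. -/

section Contractions

variable [IsManifold (𝓡 n) ∞ M] (c : ConformalStructure n M)

/-- The inverse `c^{ij}` of the Gram matrix of `c` in the frame `b`. -/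
def gramInv (x : M) (b : Frame n x) : Matrix (Fin n) (Fin n) ℝ :=
  (Matrix.of fun i j ↦ c.toFun x b (b i) (b j))⁻¹

/-- The conformal inner product of two `1`-forms, in the frame `b`. -/
def innerForm (x : M) (b : Frame n x) (ξ η : Tan n x →ₗ[ℝ] ℝ) : ℝ :=
  ∑ i, ∑ j, gramInv c x b i j * ξ (b i) * η (b j)

/-- The conformal inner product of two sections of `T*M ⊗ T*M`, in the frame `b`. -/
def innerBilin (x : M) (b : Frame n x) (P Q : Tan n x →ₗ[ℝ] Tan n x →ₗ[ℝ] ℝ) : ℝ :=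
  ∑ i, ∑ j, ∑ p, ∑ q,
    gramInv c x b i p * gramInv c x b j q * P (b i) (b j) * Q (b p) (b q)

/-- The conformal inner product of two `2`-forms (viewed as alternating bilinear forms), in the
frame `b`: the one for which the `e_i* ∧ e_j*`, `i < j`, are orthonormal if `e` is orthonormal. -/
def innerTwoForm (x : M) (b : Frame n x) (P Q : Tan n x →ₗ[ℝ] Tan n x →ₗ[ℝ] ℝ) : ℝ :=
  (1 / 2 : ℝ) * innerBilin c x b P Q

/-- The vector `ξ^♯`, in the frame `b`, characterized by `c (ξ^♯, w) = ξ w`. -/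
def sharp (x : M) (b : Frame n x) (ξ : Tan n x →ₗ[ℝ] ℝ) : Tan n x :=
  ∑ i, ∑ j, (gramInv c x b i j * ξ (b i)) • b j

variable {c} (D : WeylConnection c) (k : ℝ) (α : ∀ x : M, Frame n x → (Tan n x →ₗ[ℝ] ℝ))

/-- The conformal divergence `δ^D α = - tr_c (D α)` of a `1`-form `α` of weight `k`, in the frame
`b`: this is `- ∑ i, (D_{e_i} α)(e_i)` if `b = (e_i)` is `c`-orthonormal. -/
def codiff (x : M) (b : Frame n x) : ℝ :=
  -∑ i, ∑ j, gramInv c x b i j * covForm D.conn k α x b (b i) (b j)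

/-- The exterior derivative `d^D α = ∑ i, e_i* ∧ D_{e_i} α` of a `1`-form `α` of weight `k`, in the
frame `b`: `(d^D α)(v, w) = (D_v α)(w) - (D_w α)(v)`. -/
def extDeriv (x : M) (b : Frame n x) : Tan n x →ₗ[ℝ] Tan n x →ₗ[ℝ] ℝ :=
  covForm D.conn k α x b - (covForm D.conn k α x b).flip

/-- The Dirac operator `δ^D + d^D` on a `1`-form of weight `k`; the result is a sum of a function
of weight `k - 2` and a `2`-form of weight `k`, given as a pair. -/
def dirac (x : M) (b : Frame n x) : ℝ × (Tan n x →ₗ[ℝ] Tan n x →ₗ[ℝ] ℝ) :=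
  (codiff D k α x b, extDeriv D k α x b)

/-- `|(δ^D + d^D) α|²`; forms of different degrees are orthogonal. -/
def diracNormSq (x : M) (b : Frame n x) : ℝ :=
  (dirac D k α x b).1 ^ 2 + innerTwoForm c x b (dirac D k α x b).2 (dirac D k α x b).2

/-- `|D α|² = ⟨D α, D α⟩`. -/
def covNormSq (x : M) (b : Frame n x) : ℝ :=
  innerBilin c x b (covForm D.conn k α x b) (covForm D.conn k α x b)

/-- `Ric^D (α^♯, α^♯)`. -/
def ricciSharp (x : M) (b : Frame n x) : ℝ :=
  ricci D.conn x b (sharp c x b (α x b)) (sharp c x b (α x b))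

/-- The density `|D α|² + Ric^D (α^♯, α^♯) - |(δ^D + d^D) α|²`. -/
def bochnerDensity (x : M) (b : Frame n x) : ℝ :=
  covNormSq D k α x b + ricciSharp D α x b - diracNormSq D k α x b

/-- The `1`-form `ζ_α (X) = ⟨α, D_X α + δ^D(α) X^♭ - X ⌟ d^D α⟩`, where `X^♭ = c (X, ·)`. -/
def zeta (x : M) (b : Frame n x) : Tan n x →ₗ[ℝ] ℝ where
  toFun X := innerForm c x b (α x b)
    (covForm D.conn k α x b X + codiff D k α x b • c.toFun x b X - extDeriv D k α x b X)
  map_add' X Y := by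
    simp only [innerForm, map_add, ← Finset.sum_add_distrib, LinearMap.add_apply,
      LinearMap.sub_apply, LinearMap.smul_apply, smul_eq_mul]
    refine Finset.sum_congr rfl fun i _ ↦ Finset.sum_congr rfl fun j _ ↦ ?_
    ring
  map_smul' r X := by
    simp only [innerForm, map_smul, Finset.mul_sum, LinearMap.add_apply,
      LinearMap.sub_apply, LinearMap.smul_apply, smul_eq_mul, RingHom.id_apply]
    refine Finset.sum_congr rfl fun i _ ↦ Finset.sum_congr rfl fun j _ ↦ ?_
    ring

end Contractions

/-! ### Integration of densities of weight `-n` -/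

section Integration

open Classical in
/-- The expression of a density `s` at `y` in the coordinates of the preferred chart at `p`: the
value of `s` in the coordinate frame `(∂_1, …, ∂_n)`. -/
def coordDensity [IsManifold (𝓡 n) ∞ M] (s : ∀ x : M, Frame n x → ℝ) (p y : M) : ℝ :=
  if h : y ∈ (trivializationAt (EuclideanSpace ℝ (Fin n)) (Tan n : M → Type) p).baseSet then
    s y ((trivializationAt (EuclideanSpace ℝ (Fin n)) (Tan n : M → Type) p).basisAt
      (EuclideanSpace.basisFun (Fin n) ℝ).toBasis h)
  else 0

variable (n M) in
/-- A smooth partition of unity on `M` subordinate to the cover by the charts. -/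
def chartPartition [T2Space M] [SigmaCompactSpace M] [IsManifold (𝓡 n) ∞ M] :
    SmoothPartitionOfUnity M (𝓡 n) M univ :=
  (SmoothPartitionOfUnity.exists_isSubordinate_chartAt_source (𝓡 n) M).choose

variable [T2Space M] [SigmaCompactSpace M] [IsManifold (𝓡 n) ∞ M]

/-- The term of index `p` in the definition of the integral of a density `s`: the function
`ρ_p s(∂_1, …, ∂_n)` in the chart at `p`. -/
def localDensity (s : ∀ x : M, Frame n x → ℝ) (p : M) (u : EuclideanSpace ℝ (Fin n)) : ℝ :=
  chartPartition n M p ((chartAt (EuclideanSpace ℝ (Fin n)) p).symm u) *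
    coordDensity s p ((chartAt (EuclideanSpace ℝ (Fin n)) p).symm u)

/-- The part of `Ω` in the domain of the chart at `p`, seen in this chart. -/
def chartImage (Ω : Set M) (p : M) : Set (EuclideanSpace ℝ (Fin n)) :=
  chartAt (EuclideanSpace ℝ (Fin n)) p '' (Ω ∩ (chartAt (EuclideanSpace ℝ (Fin n)) p).source)

/-- Integrability of a density of weight `-n` on a compact set `Ω` (only finitely many terms of
the partition of unity are nonzero on `Ω`). -/
def DensityIntegrableOn (s : ∀ x : M, Frame n x → ℝ) (Ω : Set M) : Prop :=
  ∀ p : M, IntegrableOn (localDensity s p) (chartImage (n := n) Ω p) volume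

/-- The integral of a density of weight `-n` on a compact set `Ω`. -/
def densityIntegral (s : ∀ x : M, Frame n x → ℝ) (Ω : Set M) : ℝ :=
  ∑ᶠ p : M, ∫ u in chartImage (n := n) Ω p, localDensity s p u

end Integration

end Fields

end ConformalWeyl

end

/-! The equality already holds pointwise, between densities, so nothing is integrated by parts. Let
`A = α^♯`, a vector field of weight `k - 2`, and `T = D A`, an endomorphism field. Because `D c =
0`, `T` is dual to `D α` (`covForm_eq_apply_conn_sharp`). The factor `1/2` in the norm of 2-forms
gives `|Dα|² - |d^D α|² = tr (T²)` (`innerBilin_sub_half`), and `δ^D α = -tr T`, so the left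
integrand is `tr (T²) - (tr T)² + Ric (A, A)` (`bochnerDensity_eq`). In `ζ_α` the two terms `⟨α, D_X
α⟩` cancel, which leaves `ζ_α^♯ = T A - (tr T) A` (`sharp_zeta`).

By the product rule the divergence of `T A - (tr T) A` is `tr (T²) - (tr T)² + A^i (D_j D_i - D_i
D_j) A^j`. As `D` is torsion-free, the commutator contributes `Ric (A, A)` and a multiple of the
curvature of `L` evaluated on `(A, A)`; the latter is a 2-form, so it vanishes. This is
`bochnerDensity_eq_neg_codiff`, valid for every `k`. The value `k = (4 - n) / 2` only serves to make
the weight `2 k - 4` equal to `-n`.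

The work lies in passing to one moving frame. Weighted objects are functions of a frame, and
`covForm` at each point uses its own local extension of that frame, so differentiating `ζ_α`
requires independence of the extension. The key is `frameTrace_change`: under a change of frame the
trace of the connection form changes by the logarithmic derivative of the determinant, exactly what
the factor `|det|^(-k/n)` demands. Hence `covForm_apply_eq`, which permits any smooth frame. In the
frame with constant coefficients in the chart at `x`, derivatives commute and Christoffel symbols
are symmetric at `x`, and the claim becomes the identity of finite sums `divergence_algebra`.

Integrability follows since the coefficient of `δ^D ζ_α` is continuous in each chart and the
partition of unity confines it to a compact set. -/

noncomputable section

namespace ConformalWeyl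

variable {n : ℕ} {M : Type*} [TopologicalSpace M] [ChartedSpace (EuclideanSpace ℝ (Fin n)) M]
  [IsManifold (𝓡 n) ∞ M]

/-! ### Smooth functions and vector fields read in a chart -/

section Calculus

variable (n) in
/-- Smoothness of a function at a point. -/
abbrev SmoothAt (F : M → ℝ) (x : M) : Prop := ContMDiffAt (𝓡 n) 𝓘(ℝ, ℝ) ∞ F x

variable (n) in
/-- Differentiability of a function at a point. -/
abbrev DiffAt (F : M → ℝ) (x : M) : Prop := MDifferentiableAt (𝓡 n) 𝓘(ℝ, ℝ) F x

/-- Smoothness of a vector field at a point. -/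
abbrev FieldSmoothAt (X : ∀ y : M, Tan n y) (x : M) : Prop :=
  ContMDiffAt (𝓡 n) (𝓡 n).tangent ∞ (fun y ↦ (⟨y, X y⟩ : TangentBundle (𝓡 n) M)) x

/-- Differentiability of a vector field at a point. -/
abbrev FieldDiffAt (X : ∀ y : M, Tan n y) (x : M) : Prop :=
  MDifferentiableAt (𝓡 n) (𝓡 n).tangent (fun y ↦ (⟨y, X y⟩ : TangentBundle (𝓡 n) M)) x

variable (n) in
/-- The trivialization of the tangent bundle in the preferred chart at `p`. -/
abbrev chartTriv (p : M) :
    Trivialization (EuclideanSpace ℝ (Fin n)) (π (EuclideanSpace ℝ (Fin n)) (Tan n : M → Type)) :=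
  trivializationAt (EuclideanSpace ℝ (Fin n)) (Tan n : M → Type) p

variable (n) in
/-- The preferred chart at `p`. -/
abbrev chart (p : M) : OpenPartialHomeomorph M (EuclideanSpace ℝ (Fin n)) :=
  chartAt (EuclideanSpace ℝ (Fin n)) p

omit [IsManifold (𝓡 n) ∞ M] in
theorem SmoothAt.diffAt {F : M → ℝ} {x : M} (hF : SmoothAt n F x) : DiffAt n F x :=
  hF.mdifferentiableAt (by simp)

theorem FieldSmoothAt.fieldDiffAt {X : ∀ y : M, Tan n y} {x : M} (hX : FieldSmoothAt X x) :
    FieldDiffAt X x :=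
  hX.mdifferentiableAt (by simp)

theorem IsSmoothFieldOn.fieldSmoothAt {X : ∀ y : M, Tan n y} {U : Set M} (hX : IsSmoothFieldOn X U)
    (hU : IsOpen U) {x : M} (hx : x ∈ U) : FieldSmoothAt X x :=
  ContMDiffOn.contMDiffAt hX (hU.mem_nhds hx)

omit [IsManifold (𝓡 n) ∞ M] in
theorem contMDiffAt_det {x : M} {A : Fin n → Fin n → M → ℝ}
    (hA : ∀ i j, SmoothAt n (A i j) x) :
    SmoothAt n (fun y ↦ (Matrix.of fun i j ↦ A i j y).det) x := by
  simp only [Matrix.det_apply, Matrix.of_apply]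
  refine contMDiffAt_finsetSum fun σ _ ↦ ?_
  have : SmoothAt n (fun y ↦ ∏ i, A (σ i) i y) x := contMDiffAt_finsetProd fun i _ ↦ hA _ _
  have h := (contMDiffAt_const (c := ((Equiv.Perm.sign σ : ℤ) : ℝ))).mul this
  refine h.congr_of_eventuallyEq (.of_forall fun y ↦ ?_)
  simp [Units.smul_def]

theorem contMDiffAt_trivialization_coord {X : ∀ y : M, Tan n y} {x p : M}
    (hp : x ∈ (chartTriv n p).baseSet) (hX : FieldSmoothAt X x) :
    ContMDiffAt (𝓡 n) 𝓘(ℝ, EuclideanSpace ℝ (Fin n)) ∞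
      (fun y ↦ (chartTriv n p ⟨y, X y⟩).2) x :=
  ((chartTriv n p).contMDiffAt_section_iff hp).1 hX

theorem SmoothAt.contDiffAt_chart {F : M → ℝ} {y p : M}
    (hy : y ∈ (chart n p).source) (hF : SmoothAt n F y) :
    ContDiffAt ℝ ∞ (F ∘ (chart n p).symm) (chart n p y) := by
  rw [← contMDiffAt_iff_contDiffAt]
  have h := contMDiffOn_chart_symm (I := 𝓡 n) (n := ∞) (x := p)
  have h' := h.contMDiffAt ((chart n p).open_target.mem_nhds ((chart n p).map_source hy))
  refine ContMDiffAt.comp _ ?_ h'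
  rwa [(chart n p).left_inv hy]

theorem DiffAt.differentiableAt_chart {F : M → ℝ} {y p : M}
    (hy : y ∈ (chart n p).source) (hF : DiffAt n F y) :
    DifferentiableAt ℝ (F ∘ (chart n p).symm) (chart n p y) := by
  rw [← mdifferentiableAt_iff_differentiableAt]
  have h := contMDiffOn_chart_symm (I := 𝓡 n) (n := ∞) (x := p)
  have h' := (h.contMDiffAt ((chart n p).open_target.mem_nhds
    ((chart n p).map_source hy))).mdifferentiableAt (by simp)
  refine MDifferentiableAt.comp _ ?_ h'
  rwa [(chart n p).left_inv hy]

theorem chartTriv_snd_eq_mfderiv {y p : M} (hy : y ∈ (chart n p).source) (v : Tan n y) :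
    (chartTriv n p ⟨y, v⟩).2 =
      mfderiv (𝓡 n) 𝓘(ℝ, EuclideanSpace ℝ (Fin n)) (extChartAt (𝓡 n) p) y v := by
  have h1 := TangentBundle.continuousLinearMapAt_trivializationAt (I := 𝓡 n) (𝕜 := ℝ) hy
  have hb : y ∈ (chartTriv n p).baseSet := by simpa using hy
  have h2 := DFunLike.congr_fun (F := TangentSpace (𝓡 n) y →L[ℝ] EuclideanSpace ℝ (Fin n)) h1 v
  refine Eq.trans ?_ h2
  rw [Trivialization.continuousLinearMapAt_apply, Trivialization.linearMapAt_apply, if_pos hb]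

/-- The tangent trivialization at `p` is the differential of the chart at `p`, so this is the chain
rule. The chart is fixed while `y` varies, which is what allows a second differentiation. -/
theorem mvfderiv_eq_fderiv_chart {F : M → ℝ} {y p : M}
    (hy : y ∈ (chart n p).source) (hF : DiffAt n F y) (v : Tan n y) :
    mvfderiv (𝓡 n) F y v =
      fderiv ℝ (F ∘ (chart n p).symm) (chart n p y) (chartTriv n p ⟨y, v⟩).2 := by
  have h3 : F =ᶠ[𝓝 y] (F ∘ (chart n p).symm) ∘ extChartAt (𝓡 n) p := by
    filter_upwards [(chart n p).open_source.mem_nhds hy] with z hz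
    simp [(chart n p).left_inv hz]
  have hd := (hF.differentiableAt_chart hy).mdifferentiableAt
  have hc := mfderiv_comp (x := y) (I := 𝓡 n) (f := extChartAt (𝓡 n) p) (by exact hd)
    (mdifferentiableAt_extChartAt hy)
  have h4 := h3.mfderiv_eq.trans hc
  rw [mfderiv_eq_fderiv] at h4
  rw [chartTriv_snd_eq_mfderiv hy]
  exact DFunLike.congr_fun (F := TangentSpace (𝓡 n) y →L[ℝ] ℝ) h4 v

theorem contMDiffAt_mvfderiv {F : M → ℝ} {X : ∀ y : M, Tan n y} {x : M}
    (hF : SmoothAt n F x) (hX : FieldSmoothAt X x) :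
    SmoothAt n (fun y ↦ mvfderiv (𝓡 n) F y (X y)) x := by
  have hx : x ∈ (chart n x).source := mem_chart_source _ x
  have hb : x ∈ (chartTriv n x).baseSet := by simp
  have h1 : ContDiffAt ℝ ∞ (fderiv ℝ (F ∘ (chart n x).symm)) (chart n x x) :=
    (hF.contDiffAt_chart hx).fderiv_right (by simp)
  have h2 : ContMDiffAt (𝓡 n) 𝓘(ℝ, EuclideanSpace ℝ (Fin n)) ∞ (chart n x) x :=
    (contMDiffOn_chart (I := 𝓡 n) (n := ∞) (x := x)).contMDiffAt
      ((chart n x).open_source.mem_nhds hx)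
  have h3 := h1.contMDiffAt.comp x h2
  refine (h3.clm_apply (contMDiffAt_trivialization_coord hb hX)).congr_of_eventuallyEq ?_
  -- Being `C^∞` at a point does not give `C^∞` on a neighbourhood, whereas being `C^1` at a point
  -- does give `C^1` nearby, and this suffices for the chart formula.
  have hF1 : ∀ᶠ y in 𝓝 x, ContMDiffAt (𝓡 n) 𝓘(ℝ, ℝ) 1 F y :=
    (contMDiffAt_iff_contMDiffAt_nhds (by simp)).1 (ContMDiffAt.of_le hF (by simp))
  filter_upwards [(chart n x).open_source.mem_nhds hx, hF1] with y hy hy1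
  exact mvfderiv_eq_fderiv_chart hy (hy1.mdifferentiableAt (by simp)) _

/-- Cramer's rule in the trivialization at `x`: a component in a smooth moving frame is a quotient
of determinants with smooth entries and nonvanishing denominator. -/
theorem contMDiffAt_coord {e : ∀ y : M, Frame n y} {X : ∀ y : M, Tan n y} {x : M}
    (he : ∀ i, FieldSmoothAt (fun y ↦ e y i) x) (hX : FieldSmoothAt X x) (j : Fin n) :
    SmoothAt n (fun y ↦ (e y).coord j (X y)) x := by
  have hb : x ∈ (chartTriv n x).baseSet := by simp
  have hb' : ∀ᶠ y in 𝓝 x, y ∈ (chartTriv n x).baseSet :=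
    (chartTriv n x).open_baseSet.mem_nhds hb
  let A : Fin n → Fin n → M → ℝ := fun i l y ↦ (chartTriv n x ⟨y, e y l⟩).2 i
  let w : Fin n → M → ℝ := fun i y ↦ (chartTriv n x ⟨y, X y⟩).2 i
  have hcoord : ∀ {Y : ∀ y : M, Tan n y}, FieldSmoothAt Y x → ∀ i : Fin n,
      SmoothAt n (fun y ↦ (chartTriv n x ⟨y, Y y⟩).2 i) x := fun hY i ↦
    (EuclideanSpace.proj (𝕜 := ℝ) i).contMDiff.contMDiffAt.comp x
      (contMDiffAt_trivialization_coord hb hY)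
  have hA : ∀ i l, SmoothAt n (A i l) x := fun i l ↦ hcoord (he l) i
  have hw : ∀ i, SmoothAt n (w i) x := fun i ↦ hcoord hX i
  have key : ∀ y ∈ (chartTriv n x).baseSet,
      (Matrix.of fun i l ↦ A i l y).det ≠ 0 ∧
      (Matrix.of fun i l ↦ A i l y).det * (e y).coord j (X y) =
        (Matrix.of fun i l ↦ if l = j then w i y else A i l y).det := by
    intro y hy
    let L := (chartTriv n x).linearEquivAt ℝ y hy
    let B : Basis (Fin n) ℝ (EuclideanSpace ℝ (Fin n)) := (e y).map L
    have hAB : (Matrix.of fun i l ↦ A i l y) =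
        (EuclideanSpace.basisFun (Fin n) ℝ).toBasis.toMatrix B := by
      ext i l
      simp [A, B, L, Basis.toMatrix_apply]
    constructor
    · rw [hAB]
      have := (EuclideanSpace.basisFun (Fin n) ℝ).toBasis.isUnit_det B
      simpa [Basis.det_apply] using this
    · have h1 : (Matrix.of fun i l ↦ A i l y).mulVec (fun l ↦ (e y).coord l (X y)) =
          fun i ↦ w i y := by
        ext i
        have h2 := congrArg (fun v ↦ (L v) i) ((e y).sum_repr (X y))
        simp only [map_sum, map_smul] at h2
        simp [Matrix.mulVec, dotProduct, A, w]
        simp [L] at h2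
        rw [← h2]
        exact Finset.sum_congr rfl fun l _ ↦ mul_comm _ _
      have h2 := Matrix.cramer_apply (Matrix.of fun i l ↦ A i l y) (fun i ↦ w i y) j
      have h3 : (Matrix.of fun i l ↦ if l = j then w i y else A i l y) =
          (Matrix.of fun i l ↦ A i l y).updateCol j (fun i ↦ w i y) := by
        ext i l
        simp [Matrix.updateCol_apply]
      rw [h3, ← h2, ← h1, Matrix.cramer_eq_adjugate_mulVec, Matrix.mulVec_mulVec,
        Matrix.adjugate_mul, Matrix.smul_mulVec, Matrix.one_mulVec]
      simp
  have hN : SmoothAt n (fun y ↦ (Matrix.of fun i l ↦ if l = j then w i y else A i l y).det) x :=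
    contMDiffAt_det (A := fun i l y ↦ if l = j then w i y else A i l y) fun i l ↦ by
      by_cases h : l = j
      · simpa [h] using hw i
      · simpa [h] using hA i l
  refine (hN.div₀ (contMDiffAt_det hA) (key x hb).1).congr_of_eventuallyEq ?_
  filter_upwards [hb'] with y hy
  exact (eq_div_iff (key y hy).1).2 (by rw [mul_comm]; exact (key y hy).2)

end Calculus

/-! ### Local extensions of vectors and frames, constant in the chart -/

section Extend

variable (n) in
theorem chartTriv_extend {x : M} (v : Tan n x) {y : M} (hy : y ∈ (chartTriv n x).baseSet) :
    (chartTriv n x ⟨y, FiberBundle.extend (EuclideanSpace ℝ (Fin n)) v y⟩).2 =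
      (chartTriv n x ⟨x, v⟩).2 := by
  rw [FiberBundle.extend, Trivialization.apply_mk_symm _ hy]

/-- Over the whole base set the trivialization carries the extended vectors to a fixed basis, so the
arbitrary default frame in `extendFrame` is never taken there. -/
theorem extendFrame_apply {x : M} (b : Frame n x) {y : M} (hy : y ∈ (chartTriv n x).baseSet)
    (j : Fin n) :
    extendFrame b y j = FiberBundle.extend (EuclideanSpace ℝ (Fin n)) (b j) y := by
  have hx : x ∈ (chartTriv n x).baseSet := by simp
  let B : Frame n y := (b.map ((chartTriv n x).linearEquivAt ℝ x hx)).map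
    ((chartTriv n x).linearEquivAt ℝ y hy).symm
  have hB : (fun i ↦ (FiberBundle.extend (EuclideanSpace ℝ (Fin n)) (b i) y : Tan n y)) = B := by
    ext1 i
    apply ((chartTriv n x).linearEquivAt ℝ y hy).injective
    have := chartTriv_extend n (b i) hy
    simpa [B, Trivialization.apply_mk_symm _ hy] using this
  have h : LinearIndependent ℝ
      (fun i ↦ (FiberBundle.extend (EuclideanSpace ℝ (Fin n)) (b i) y : Tan n y)) ∧
      ⊤ ≤ Submodule.span ℝ (Set.range
        (fun i ↦ (FiberBundle.extend (EuclideanSpace ℝ (Fin n)) (b i) y : Tan n y))) := by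
    rw [hB]
    exact ⟨B.linearIndependent, B.span_eq.ge⟩
  simp [extendFrame, h]

theorem extendFrame_self {x : M} (b : Frame n x) : extendFrame b x = b := by
  ext1 j
  rw [extendFrame_apply b (by simp)]
  simp

theorem isSmoothFieldOn_extend {x : M} (v : Tan n x) :
    IsSmoothFieldOn (FiberBundle.extend (EuclideanSpace ℝ (Fin n)) v) (chartTriv n x).baseSet := by
  intro y hy
  apply ContMDiffAt.contMDiffWithinAt
  refine ((chartTriv n x).contMDiffAt_section_iff hy).2 ?_
  refine (contMDiffAt_const (c := (chartTriv n x ⟨x, v⟩).2)).congr_of_eventuallyEq ?_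
  filter_upwards [(chartTriv n x).open_baseSet.mem_nhds hy] with z hz
  exact chartTriv_extend n v hz

theorem isSmoothFrameOn_extendFrame {x : M} (b : Frame n x) :
    IsSmoothFrameOn (extendFrame b) (chartTriv n x).baseSet := fun i ↦
  (isSmoothFieldOn_extend (b i)).congr fun y hy ↦ by
    simp only [extendFrame_apply b hy]

theorem lieBracketWithin_eq_zero_of_eventuallyEq_const {E : Type*} [NormedAddCommGroup E]
    [NormedSpace ℝ E] {V W : E → E} {v w u : E} (hV : V =ᶠ[𝓝 u] fun _ ↦ v)
    (hW : W =ᶠ[𝓝 u] fun _ ↦ w) (s : Set E) : VectorField.lieBracketWithin ℝ V W s u = 0 := by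
  rw [VectorField.lieBracketWithin, (hV.filter_mono nhdsWithin_le_nhds).fderivWithin_eq hV.eq_of_nhds,
    (hW.filter_mono nhdsWithin_le_nhds).fderivWithin_eq hW.eq_of_nhds]
  simp

/-- In the chart at `x` both extensions are constant fields, and constant fields commute. -/
theorem mlieBracket_extend {x : M} (v w : Tan n x) :
    VectorField.mlieBracket (𝓡 n) (FiberBundle.extend (EuclideanSpace ℝ (Fin n)) v)
      (FiberBundle.extend (EuclideanSpace ℝ (Fin n)) w) x = 0 := by
  have hx : extChartAt (𝓡 n) x x ∈ (extChartAt (𝓡 n) x).target := mem_extChartAt_target x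
  have key : ∀ v : Tan n x, VectorField.mpullbackWithin 𝓘(ℝ, EuclideanSpace ℝ (Fin n)) (𝓡 n)
      (extChartAt (𝓡 n) x).symm (FiberBundle.extend (EuclideanSpace ℝ (Fin n)) v)
      (range (𝓡 n)) =ᶠ[𝓝 (extChartAt (𝓡 n) x x)] fun _ ↦ (chartTriv n x ⟨x, v⟩).2 := by
    intro v
    filter_upwards [extChartAt_target_mem_nhds (I := 𝓡 n) x] with u hu
    have hy : (extChartAt (𝓡 n) x).symm u ∈ (chart n x).source := by
      simpa using (extChartAt (𝓡 n) x).map_target hu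
    have hL := TangentBundle.symmL_trivializationAt (I := 𝓡 n) (𝕜 := ℝ) hy
    rw [(extChartAt (𝓡 n) x).right_inv hu] at hL
    rw [VectorField.mpullbackWithin_apply]
    have h2 := DFunLike.congr_fun
      (F := EuclideanSpace ℝ (Fin n) →L[ℝ] TangentSpace (𝓡 n) ((extChartAt (𝓡 n) x).symm u)) hL
      (chartTriv n x ⟨x, v⟩).2
    have h3 : FiberBundle.extend (EuclideanSpace ℝ (Fin n)) v ((extChartAt (𝓡 n) x).symm u) =
      (chartTriv n x).symmL ℝ ((extChartAt (𝓡 n) x).symm u) (chartTriv n x ⟨x, v⟩).2 := by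
      rw [FiberBundle.extend, Trivialization.symmL_apply]
      simpa using hy
    rw [h3]
    refine (congrArg _ h2).trans ?_
    exact (isInvertible_mfderivWithin_extChartAt_symm hu).inverse_apply_self _
  rw [← VectorField.mlieBracketWithin_univ, VectorField.mlieBracketWithin_apply]
  refine (congrArg _ (lieBracketWithin_eq_zero_of_eventuallyEq_const (key v) (key w) _)).trans ?_
  exact map_zero _

/-- The derivatives of a function along the fields extending two vectors commute. -/
theorem mvfderiv_mvfderiv_extend_comm {F : M → ℝ} {x : M} (hF : SmoothAt n F x) (v w : Tan n x) :
    mvfderiv (𝓡 n) (fun y ↦ mvfderiv (𝓡 n) F y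
        (FiberBundle.extend (EuclideanSpace ℝ (Fin n)) v y)) x w =
      mvfderiv (𝓡 n) (fun y ↦ mvfderiv (𝓡 n) F y
        (FiberBundle.extend (EuclideanSpace ℝ (Fin n)) w y)) x v := by
  have hx : x ∈ (chart n x).source := mem_chart_source _ x
  have hF1 : ∀ᶠ y in 𝓝 x, ContMDiffAt (𝓡 n) 𝓘(ℝ, ℝ) 1 F y :=
    (contMDiffAt_iff_contMDiffAt_nhds (by simp)).1 (ContMDiffAt.of_le hF (by simp))
  have hE : ∀ v : Tan n x, (fun y ↦ mvfderiv (𝓡 n) F y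
      (FiberBundle.extend (EuclideanSpace ℝ (Fin n)) v y)) ∘ (chart n x).symm =ᶠ[𝓝 (chart n x x)]
      fun u ↦ fderiv ℝ (F ∘ (chart n x).symm) u (chartTriv n x ⟨x, v⟩).2 := by
    intro v
    have h1 : ∀ᶠ u in 𝓝 (chart n x x), (chart n x).symm u ∈ (chart n x).source ∧
        ContMDiffAt (𝓡 n) 𝓘(ℝ, ℝ) 1 F ((chart n x).symm u) := by
      have h2 : Filter.Tendsto (chart n x).symm (𝓝 (chart n x x)) (𝓝 x) := by
        have := (chart n x).continuousAt_symm ((chart n x).map_source hx)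
        rwa [ContinuousAt, (chart n x).left_inv hx] at this
      exact h2.eventually (((chart n x).open_source.eventually_mem hx).and hF1)
    filter_upwards [h1, (chart n x).open_target.mem_nhds ((chart n x).map_source hx)]
      with u hu hu2
    have hb : (chart n x).symm u ∈ (chartTriv n x).baseSet := by simpa using hu.1
    simp only [Function.comp_apply]
    rw [mvfderiv_eq_fderiv_chart hu.1 (hu.2.mdifferentiableAt (by simp)),
      chartTriv_extend n v hb, (chart n x).right_inv hu2]
  have hC := hF.contDiffAt_chart hx
  have hC' : DifferentiableAt ℝ (fderiv ℝ (F ∘ (chart n x).symm)) (chart n x x) :=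
    (hC.fderiv_right (m := 1) (ENat.LEInfty.out (m := 2))).differentiableAt (by simp)
  have hD : ∀ v w : Tan n x, mvfderiv (𝓡 n) (fun y ↦ mvfderiv (𝓡 n) F y
        (FiberBundle.extend (EuclideanSpace ℝ (Fin n)) v y)) x w =
      fderiv ℝ (fderiv ℝ (F ∘ (chart n x).symm)) (chart n x x) (chartTriv n x ⟨x, w⟩).2
        (chartTriv n x ⟨x, v⟩).2 := by
    intro v w
    have hs : SmoothAt n (fun y ↦ mvfderiv (𝓡 n) F y
        (FiberBundle.extend (EuclideanSpace ℝ (Fin n)) v y)) x :=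
      contMDiffAt_mvfderiv hF
        ((isSmoothFieldOn_extend v).fieldSmoothAt (chartTriv n x).open_baseSet (by simp))
    rw [mvfderiv_eq_fderiv_chart hx hs.diffAt, (hE v).fderiv_eq,
      fderiv_clm_apply hC' (by fun_prop)]
    simp
  rw [hD, hD]
  exact hC.isSymmSndFDerivAt (by simpa using ENat.LEInfty.out (m := 2)) _ _

end Extend

/-! ### Leibniz rule and locality of the connection -/

section Connection

theorem FieldDiffAt.sum_smul {e : ∀ y : M, Frame n y} {x : M}
    (he : ∀ i, FieldDiffAt (fun y ↦ e y i) x) {F : Fin n → M → ℝ} (hF : ∀ i, DiffAt n (F i) x)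
    (s : Finset (Fin n)) : FieldDiffAt (fun y ↦ ∑ i ∈ s, F i y • e y i) x :=
  MDifferentiableAt.sum_section fun i _ ↦ (hF i).smul_section (he i)

theorem IsSmoothFrameOn.sum_smul {e : ∀ y : M, Frame n y} {U : Set M}
    (he : IsSmoothFrameOn e U) {F : Fin n → M → ℝ}
    (hF : ∀ i, ContMDiffOn (𝓡 n) 𝓘(ℝ, ℝ) ∞ (F i) U) :
    IsSmoothFieldOn (fun y ↦ ∑ i, F i y • e y i) U :=
  ContMDiffOn.sum_section fun i _ ↦ (hF i).smul_section (he i)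

theorem IsSmoothFrameOn.fieldSmoothAt {e : ∀ y : M, Frame n y} {U : Set M}
    (he : IsSmoothFrameOn e U) (hU : IsOpen U) {x : M} (hx : x ∈ U) (i : Fin n) :
    FieldSmoothAt (fun y ↦ e y i) x :=
  (he i).fieldSmoothAt hU hx

variable {D : CovariantDerivative (𝓡 n) (EuclideanSpace ℝ (Fin n)) (Tan n : M → Type)}

theorem conn_sum_smul {e : ∀ y : M, Frame n y} {x : M}
    (he : ∀ i, FieldDiffAt (fun y ↦ e y i) x) {F : Fin n → M → ℝ} (hF : ∀ i, DiffAt n (F i) x)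
    (v : Tan n x) :
    D (fun y ↦ ∑ i, F i y • e y i) x v =
      ∑ i, (F i x • D (fun y ↦ e y i) x v + mvfderiv (𝓡 n) (F i) x v • e x i) := by
  have key : ∀ s : Finset (Fin n), D (fun y ↦ ∑ i ∈ s, F i y • e y i) x v =
      ∑ i ∈ s, (F i x • D (fun y ↦ e y i) x v + mvfderiv (𝓡 n) (F i) x v • e x i) := by
    intro s
    induction s using Finset.induction_on with
    | empty =>
      simp only [Finset.sum_empty]
      have := congrFun (CovariantDerivative.zero D) x
      exact DFunLike.congr_fun this v
    | insert a s ha ih =>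
      rw [Finset.sum_insert ha, ← ih]
      have h1 : (fun y ↦ ∑ i ∈ insert a s, F i y • e y i) =
          (F a • fun y ↦ e y a) + fun y ↦ ∑ i ∈ s, F i y • e y i := by
        funext y
        simp [Finset.sum_insert ha]
      rw [h1, D.isCovariantDerivativeOnUniv.add ((hF a).smul_section (he a))
        (FieldDiffAt.sum_smul he hF s), D.isCovariantDerivativeOnUniv.leibniz (he a) (hF a)]
      rfl
  exact key Finset.univ

theorem conn_congr {X Y : ∀ y : M, Tan n y} {x : M} (hX : FieldDiffAt X x) (hY : FieldDiffAt Y x)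
    (h : ∀ᶠ y in 𝓝 x, X y = Y y) : D X x = D Y x :=
  D.isCovariantDerivativeOnUniv.congr_of_eventuallyEq hX hY Filter.univ_mem h

/-- Smoothness of `D` is applied to a globally smooth section, so `X` is first cut off by a bump
function supported in `U`. The cut-off field equals `X` near `x`, and there `D` does not see the
difference. -/
theorem fieldSmoothAt_conn [T2Space M] (hD : CovariantDerivative.ContMDiffCovariantDerivative D ∞)
    {X Y : ∀ y : M, Tan n y} {U : Set M} (hU : IsOpen U) (hX : IsSmoothFieldOn X U) {x : M}
    (hx : x ∈ U) (hY : FieldSmoothAt Y x) : FieldSmoothAt (fun y ↦ D X y (Y y)) x := by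
  obtain ⟨f, -, hf⟩ :=
    (SmoothBumpFunction.nhds_basis_tsupport (I := 𝓡 n) x).mem_iff.1 (hU.mem_nhds hx)
  have h1 : ContMDiff (𝓡 n) (𝓡 n).tangent ∞
      (fun y ↦ (⟨y, ((f : M → ℝ) • X) y⟩ : TangentBundle (𝓡 n) M)) :=
    ContMDiffOn.smul_section_of_tsupport f.contMDiff.contMDiffOn hU hf hX
  have h2 := hD.contMDiff.contMDiff (σ := ((f : M → ℝ) • X : ∀ y : M, Tan n y)) h1.contMDiffOn
  have h3 := ContMDiffAt.clm_bundle_apply (h2.contMDiffAt Filter.univ_mem) hY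
  refine h3.congr_of_eventuallyEq ?_
  filter_upwards [hU.mem_nhds hx, f.eventuallyEq_one.eventuallyEq_nhds] with y hy hfy
  have h4 : D ((f : M → ℝ) • X : ∀ y : M, Tan n y) y = D X y := by
    refine conn_congr (h1.contMDiffAt.mdifferentiableAt (by simp))
      (hX.fieldSmoothAt hU hy).fieldDiffAt ?_
    filter_upwards [hfy] with z hz
    simp [hz]
  rw [← h4]

end Connection

/-! ### Differentiation rules for real functions on `M` -/

section Derivatives

omit [IsManifold (𝓡 n) ∞ M] in
theorem mvfderiv_congr {F G : M → ℝ} {x : M} (h : F =ᶠ[𝓝 x] G) :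
    mvfderiv (𝓡 n) F x = mvfderiv (𝓡 n) G x := by
  ext v
  exact DFunLike.congr_fun (F := TangentSpace (𝓡 n) x →L[ℝ] ℝ) h.mfderiv_eq v

theorem mvfderiv_comp_hasDerivAt {F : M → ℝ} {x : M} (hF : DiffAt n F x) {g : ℝ → ℝ} {g' : ℝ}
    (hg : HasDerivAt g g' (F x)) :
    DiffAt n (fun y ↦ g (F y)) x ∧
      ∀ v : Tan n x, mvfderiv (𝓡 n) (fun y ↦ g (F y)) x v = g' * mvfderiv (𝓡 n) F x v := by
  have hx : x ∈ (chart n x).source := mem_chart_source _ x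
  have hd : DiffAt n (fun y ↦ g (F y)) x :=
    MDifferentiableAt.comp x hg.differentiableAt.mdifferentiableAt hF
  refine ⟨hd, fun v ↦ ?_⟩
  rw [mvfderiv_eq_fderiv_chart hx hd, mvfderiv_eq_fderiv_chart hx hF]
  have h1 := (hF.differentiableAt_chart hx).hasFDerivAt
  have h2 : HasDerivAt g g' ((F ∘ (chart n x).symm) (chart n x x)) := by
    simpa [(chart n x).left_inv hx] using hg
  have h3 := (h2.comp_hasFDerivAt _ h1).fderiv
  have h4 : (fun y ↦ g (F y)) ∘ (chart n x).symm = g ∘ (F ∘ (chart n x).symm) := rfl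
  rw [h4, h3]
  simp

omit [IsManifold (𝓡 n) ∞ M] in
theorem mvfderiv_const_apply {x : M} (a : ℝ) (v : Tan n x) :
    mvfderiv (𝓡 n) (fun _ ↦ a) x v = 0 :=
  DFunLike.congr_fun (mvfderiv_const a) v

omit [IsManifold (𝓡 n) ∞ M] in
theorem mvfderiv_mul_apply {F G : M → ℝ} {x : M} (hF : DiffAt n F x) (hG : DiffAt n G x)
    (v : Tan n x) :
    mvfderiv (𝓡 n) (fun y ↦ F y * G y) x v =
      F x * mvfderiv (𝓡 n) G x v + mvfderiv (𝓡 n) F x v * G x := by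
  have := DFunLike.congr_fun (mvfderiv_mul hF hG) v
  refine this.trans ?_
  simp [mul_comm]

omit [IsManifold (𝓡 n) ∞ M] in
theorem mvfderiv_add_apply {F G : M → ℝ} {x : M} (hF : DiffAt n F x) (hG : DiffAt n G x)
    (v : Tan n x) :
    mvfderiv (𝓡 n) (fun y ↦ F y + G y) x v =
      mvfderiv (𝓡 n) F x v + mvfderiv (𝓡 n) G x v :=
  DFunLike.congr_fun (mvfderiv_add hF hG) v

omit [IsManifold (𝓡 n) ∞ M] in
theorem mvfderiv_sub_apply {F G : M → ℝ} {x : M} (hF : DiffAt n F x) (hG : DiffAt n G x)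
    (v : Tan n x) :
    mvfderiv (𝓡 n) (fun y ↦ F y - G y) x v =
      mvfderiv (𝓡 n) F x v - mvfderiv (𝓡 n) G x v :=
  DFunLike.congr_fun (mvfderiv_sub hF hG) v

omit [IsManifold (𝓡 n) ∞ M] in
theorem mvfderiv_const_mul_apply {F : M → ℝ} {x : M} (hF : DiffAt n F x) (a : ℝ)
    (v : Tan n x) :
    mvfderiv (𝓡 n) (fun y ↦ a * F y) x v = a * mvfderiv (𝓡 n) F x v := by
  rw [mvfderiv_mul_apply mdifferentiableAt_const hF, mvfderiv_const_apply]
  ring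

omit [IsManifold (𝓡 n) ∞ M] in
theorem DiffAt.sum {ι : Type*} (s : Finset ι) {F : ι → M → ℝ} {x : M}
    (hF : ∀ i, DiffAt n (F i) x) : DiffAt n (fun y ↦ ∑ i ∈ s, F i y) x := by
  classical
  induction s using Finset.induction_on with
  | empty => simpa using mdifferentiableAt_const
  | insert a s ha ih =>
    simp only [Finset.sum_insert ha]
    exact (hF a).add ih

omit [IsManifold (𝓡 n) ∞ M] in
theorem mvfderiv_sum_apply {ι : Type*} (s : Finset ι) {F : ι → M → ℝ} {x : M}
    (hF : ∀ i, DiffAt n (F i) x) (v : Tan n x) :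
    mvfderiv (𝓡 n) (fun y ↦ ∑ i ∈ s, F i y) x v = ∑ i ∈ s, mvfderiv (𝓡 n) (F i) x v := by
  classical
  induction s using Finset.induction_on with
  | empty => simpa using mvfderiv_const_apply _ v
  | insert a s ha ih =>
    simp only [Finset.sum_insert ha]
    rw [mvfderiv_add_apply (hF a) (DiffAt.sum s hF), ih]

omit [IsManifold (𝓡 n) ∞ M] in
theorem DiffAt.prod {ι : Type*} (s : Finset ι) {F : ι → M → ℝ} {x : M}
    (hF : ∀ i, DiffAt n (F i) x) : DiffAt n (fun y ↦ ∏ i ∈ s, F i y) x := by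
  classical
  induction s using Finset.induction_on with
  | empty => simpa using mdifferentiableAt_const
  | insert a s ha ih =>
    simp only [Finset.prod_insert ha]
    exact (hF a).mul ih

omit [IsManifold (𝓡 n) ∞ M] in
theorem mvfderiv_prod_apply {ι : Type*} [DecidableEq ι] (s : Finset ι) {F : ι → M → ℝ} {x : M}
    (hF : ∀ i, DiffAt n (F i) x) (v : Tan n x) :
    mvfderiv (𝓡 n) (fun y ↦ ∏ i ∈ s, F i y) x v =
      ∑ i ∈ s, mvfderiv (𝓡 n) (F i) x v * ∏ j ∈ s.erase i, F j x := by
  induction s using Finset.induction_on with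
  | empty => simpa using mvfderiv_const_apply _ v
  | insert a s ha ih =>
    simp only [Finset.prod_insert ha]
    rw [mvfderiv_mul_apply (hF a) (DiffAt.prod s hF), ih, Finset.sum_insert ha,
      Finset.erase_insert ha, add_comm, Finset.mul_sum]
    congr 1
    refine Finset.sum_congr rfl fun i hi ↦ ?_
    have hai : a ≠ i := fun h ↦ ha (h ▸ hi)
    rw [Finset.erase_insert_of_ne hai, Finset.prod_insert (by simp [ha])]
    ring

-- Product rule on each term of the Leibniz expansion. The sum over replaced columns is the form
-- from which `frameTrace_change` obtains Jacobi's formula.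
omit [IsManifold (𝓡 n) ∞ M] in
theorem mvfderiv_det_apply {A : Fin n → Fin n → M → ℝ} {x : M} (hA : ∀ i j, DiffAt n (A i j) x)
    (v : Tan n x) :
    DiffAt n (fun y ↦ (Matrix.of fun i j ↦ A i j y).det) x ∧
    mvfderiv (𝓡 n) (fun y ↦ (Matrix.of fun i j ↦ A i j y).det) x v =
      ∑ j, ((Matrix.of fun i j ↦ A i j x).updateCol j fun i ↦ mvfderiv (𝓡 n) (A i j) x v).det := by
  have h0 : (fun y ↦ (Matrix.of fun i j ↦ A i j y).det) =
      fun y ↦ ∑ σ : Equiv.Perm (Fin n), ((Equiv.Perm.sign σ : ℤ) : ℝ) * ∏ i, A (σ i) i y := by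
    funext y
    simp [Matrix.det_apply']
  have hd : ∀ σ : Equiv.Perm (Fin n),
      DiffAt n (fun y ↦ ((Equiv.Perm.sign σ : ℤ) : ℝ) * ∏ i, A (σ i) i y) x := fun σ ↦
    MDifferentiableAt.mul (p := fun _ ↦ ((Equiv.Perm.sign σ : ℤ) : ℝ))
      (q := fun y ↦ ∏ i, A (σ i) i y) mdifferentiableAt_const (DiffAt.prod _ fun i ↦ hA _ _)
  rw [h0]
  refine ⟨DiffAt.sum _ hd, ?_⟩
  rw [mvfderiv_sum_apply _ hd]
  simp only [Matrix.det_apply']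
  rw [Finset.sum_comm]
  refine Finset.sum_congr rfl fun σ _ ↦ ?_
  rw [mvfderiv_const_mul_apply (DiffAt.prod _ fun i ↦ hA _ _), mvfderiv_prod_apply _ fun i ↦ hA _ _,
    Finset.mul_sum]
  refine Finset.sum_congr rfl fun j _ ↦ ?_
  congr 1
  rw [← Finset.mul_prod_erase _ _ (Finset.mem_univ j)]
  simp only [Matrix.updateCol_self]
  congr 1
  refine Finset.prod_congr rfl fun i hi ↦ ?_
  rw [Matrix.updateCol_ne (Finset.ne_of_mem_erase hi)]
  rfl

end Derivatives

/-! ### Change of moving frame for functions with a weight -/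

section FrameChange

theorem abs_rpow_hasDerivAt {t : ℝ} (ht : t ≠ 0) (p : ℝ) :
    HasDerivAt (fun t : ℝ ↦ |t| ^ p) (p * |t| ^ p / t) t := by
  have h := (hasDerivAt_abs ht).rpow_const (p := p) (Or.inl (abs_ne_zero.2 ht))
  convert h using 1
  rw [Real.rpow_sub_one (abs_ne_zero.2 ht)]
  have h1 : |t| ≠ 0 := abs_ne_zero.2 ht
  rcases lt_or_gt_of_ne ht with h2 | h2
  · rw [abs_of_neg h2] at h1 ⊢
    simp [h2]
    field_simp
  · rw [abs_of_pos h2] at h1 ⊢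
    simp [h2]
    field_simp

variable (D : CovariantDerivative (𝓡 n) (EuclideanSpace ℝ (Fin n)) (Tan n : M → Type))

/-- The trace of the connection form of `D` in a moving frame. -/
def frameTrace (e : ∀ y : M, Frame n y) (x : M) : Tan n x →ₗ[ℝ] ℝ :=
  ∑ i, (e x).coord i ∘ₗ (D (fun y ↦ e y i) x).toLinearMap

theorem frameTrace_apply (e : ∀ y : M, Frame n y) (x : M) (v : Tan n x) :
    frameTrace D e x v = ∑ i, (e x).coord i (D (fun y ↦ e y i) x v) := by
  simp [frameTrace]

/-- The covariant derivative of a function of weight `k`, in the trivialization given by a moving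
frame. -/
def covScalar (k : ℝ) (s : ∀ y : M, Frame n y → ℝ) (e : ∀ y : M, Frame n y) (x : M) :
    Tan n x →ₗ[ℝ] ℝ :=
  (mvfderiv (𝓡 n) (fun y ↦ s y (e y)) x).toLinearMap + (k / (n : ℝ) * s x (e x)) • frameTrace D e x

theorem covScalar_apply (k : ℝ) (s : ∀ y : M, Frame n y → ℝ) (e : ∀ y : M, Frame n y) (x : M)
    (v : Tan n x) :
    covScalar D k s e x v =
      mvfderiv (𝓡 n) (fun y ↦ s y (e y)) x v + k / (n : ℝ) * s x (e x) * frameTrace D e x v :=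
  rfl

variable {D} {e f : ∀ y : M, Frame n y} {x : M}

theorem diffAt_coord (he : ∀ i, FieldSmoothAt (fun y ↦ e y i) x)
    (hf : ∀ i, FieldSmoothAt (fun y ↦ f y i) x) (i j : Fin n) :
    DiffAt n (fun y ↦ (f y).coord i (e y j)) x :=
  SmoothAt.diffAt (contMDiffAt_coord hf (he j) i)

omit [IsManifold (𝓡 n) ∞ M] in
theorem frame_det_eq (y : M) :
    (f y).det (e y) = (Matrix.of fun i j ↦ (f y).coord i (e y j)).det := by
  rw [Basis.det_apply]
  rfl

omit [IsManifold (𝓡 n) ∞ M] in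
theorem frame_eq_sum (j : Fin n) :
    (fun y ↦ e y j) = fun y ↦ ∑ i, (f y).coord i (e y j) • f y i := by
  funext y
  exact ((f y).sum_repr (e y j)).symm

theorem conn_frame_eq (he : ∀ i, FieldSmoothAt (fun y ↦ e y i) x)
    (hf : ∀ i, FieldSmoothAt (fun y ↦ f y i) x) (j : Fin n) (v : Tan n x) :
    D (fun y ↦ e y j) x v = ∑ i, ((f x).coord i (e x j) • D (fun y ↦ f y i) x v +
      mvfderiv (𝓡 n) (fun y ↦ (f y).coord i (e y j)) x v • f x i) := by
  rw [frame_eq_sum (e := e) (f := f) j,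
    conn_sum_smul (fun i ↦ (hf i).fieldDiffAt) fun i ↦ diffAt_coord he hf i j]

/-- The connection matrix in `e = f A` is `A⁻¹ ω A + A⁻¹ dA`. The trace of the first term does not
depend on the basis, and that of the second is the logarithmic derivative of `det A`. -/
theorem frameTrace_change (he : ∀ i, FieldSmoothAt (fun y ↦ e y i) x)
    (hf : ∀ i, FieldSmoothAt (fun y ↦ f y i) x) (v : Tan n x) :
    DiffAt n (fun y ↦ (f y).det (e y)) x ∧
    frameTrace D e x v = frameTrace D f x v +
      mvfderiv (𝓡 n) (fun y ↦ (f y).det (e y)) x v / (f x).det (e x) := by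
  have hdet := mvfderiv_det_apply (A := fun i j y ↦ (f y).coord i (e y j))
    (fun i j ↦ diffAt_coord he hf i j) v
  simp only [← frame_det_eq] at hdet
  refine ⟨hdet.1, ?_⟩
  have hne : (f x).det (e x) ≠ 0 := ((f x).isUnit_det (e x)).ne_zero
  -- Jacobi's formula without inverse matrices: replacing column `j` by the derivative means
  -- replacing `e_j` by `w` in the alternating form, and only the `e_j`-component of `w` survives.
  have h1 : mvfderiv (𝓡 n) (fun y ↦ (f y).det (e y)) x v =
      (f x).det (e x) * ∑ j, (e x).coord j
        (∑ i, mvfderiv (𝓡 n) (fun y ↦ (f y).coord i (e y j)) x v • f x i) := by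
    rw [hdet.2, Finset.mul_sum]
    refine Finset.sum_congr rfl fun j _ ↦ ?_
    set w := ∑ i, mvfderiv (𝓡 n) (fun y ↦ (f y).coord i (e y j)) x v • f x i with hw
    have h2 : ((Matrix.of fun i j ↦ (f x).coord i (e x j)).updateCol j
        fun i ↦ mvfderiv (𝓡 n) (fun y ↦ (f y).coord i (e y j)) x v) =
        (f x).toMatrix (Function.update (e x) j w) := by
      ext i l
      by_cases h : l = j
      · subst h
        simp [Basis.toMatrix_apply, hw, Finsupp.single_apply]
      · simp [Basis.toMatrix_apply, h]
    rw [h2, ← Basis.det_apply]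
    conv_lhs => rw [← (e x).sum_repr w]
    rw [AlternatingMap.map_update_sum, Finset.sum_eq_single j]
    · rw [AlternatingMap.map_update_smul, Function.update_eq_self]
      simp [mul_comm]
    · intro l _ hl
      rw [AlternatingMap.map_update_smul, AlternatingMap.map_update_self _ _ hl.symm]
      simp
    · simp
  -- Both sides are the trace of the endomorphism `f_i ↦ D_v f_i`, computed in the bases `e x` and
  -- `f x`.
  have h3 : ∑ j, (e x).coord j (∑ i, (f x).coord i (e x j) • D (fun y ↦ f y i) x v) =
      frameTrace D f x v := by
    have h4 := LinearMap.trace_eq_matrix_trace ℝ (e x) ((f x).constr ℝ fun i ↦ D (fun y ↦ f y i) x v)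
    rw [LinearMap.trace_eq_matrix_trace ℝ (f x)] at h4
    simp only [Matrix.trace, Matrix.diag, LinearMap.toMatrix_apply, Basis.constr_apply_fintype] at h4
    rw [frameTrace_apply]
    refine Eq.trans h4.symm ?_
    simp [Basis.equivFun_self, ite_smul]
  rw [h1, mul_div_cancel_left₀ _ hne, frameTrace_apply, ← h3, ← Finset.sum_add_distrib]
  refine Finset.sum_congr rfl fun j _ ↦ ?_
  rw [conn_frame_eq he hf, Finset.sum_add_distrib, map_add]

/-- Differentiating the factor `|det|^(-k/n)` produces `-(k/n)` times the logarithmic derivative of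
the determinant. The term `k/n` times the change of the trace cancels it. -/
theorem covScalar_change {k : ℝ} {s : ∀ y : M, Frame n y → ℝ}
    (hs : HasWeight (V := fun _ : M ↦ ℝ) k s) (he : ∀ i, FieldSmoothAt (fun y ↦ e y i) x)
    (hf : ∀ i, FieldSmoothAt (fun y ↦ f y i) x) (hsf : DiffAt n (fun y ↦ s y (f y)) x)
    (v : Tan n x) :
    covScalar D k s e x v =
      |(f x).det (e x)| ^ (-k / (n : ℝ)) * covScalar D k s f x v := by
  obtain ⟨hd, htr⟩ := frameTrace_change (D := D) he hf v
  have hne : (f x).det (e x) ≠ 0 := ((f x).isUnit_det (e x)).ne_zero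
  obtain ⟨hpd, hp⟩ := mvfderiv_comp_hasDerivAt hd (abs_rpow_hasDerivAt hne (-k / (n : ℝ)))
  have h1 : (fun y ↦ s y (e y)) =
      fun y ↦ |(f y).det (e y)| ^ (-k / (n : ℝ)) * s y (f y) := by
    funext y
    exact hs y (f y) (e y)
  rw [covScalar_apply, covScalar_apply, h1, mvfderiv_mul_apply hpd hsf, hp, htr, congrFun h1 x]
  field_simp
  ring

end FrameChange

/-! ### Independence of `D α` from the extensions of frame and field -/

section FormDerivative

variable (D : CovariantDerivative (𝓡 n) (EuclideanSpace ℝ (Fin n)) (Tan n : M → Type))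

/-- Differentiability at `x` of a family of `1`-forms depending on a frame: its value in a moving
frame on a vector field, both smooth near `x`, is differentiable at `x`. -/
def FormDiffAt (α : ∀ y : M, Frame n y → (Tan n y →ₗ[ℝ] ℝ)) (x : M) : Prop :=
  ∀ U : Set M, IsOpen U → x ∈ U → ∀ e : (∀ y : M, Frame n y), IsSmoothFrameOn e U →
    ∀ X : (∀ y : M, Tan n y), IsSmoothFieldOn X U → DiffAt n (fun y ↦ α y (e y) (X y)) x

/-- The expression `(D_v α)(X)` computed in a moving frame `e`. -/
def formCov (k : ℝ) (α : ∀ y : M, Frame n y → (Tan n y →ₗ[ℝ] ℝ)) (e : ∀ y : M, Frame n y)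
    (X : ∀ y : M, Tan n y) (x : M) (v : Tan n x) : ℝ :=
  covScalar D k (fun y b ↦ α y b (X y)) e x v - α x (e x) (D X x v)

variable {D} {k : ℝ} {α : ∀ y : M, Frame n y → (Tan n y →ₗ[ℝ] ℝ)} {e f : ∀ y : M, Frame n y}
  {x : M} {U : Set M}

theorem IsSmoothFrameOn.inter_left {V : Set M} (he : IsSmoothFrameOn e U) :
    IsSmoothFrameOn e (U ∩ V) := fun i ↦ (he i).mono inter_subset_left

theorem IsSmoothFrameOn.inter_right {V : Set M} (he : IsSmoothFrameOn e U) :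
    IsSmoothFrameOn e (V ∩ U) := fun i ↦ (he i).mono inter_subset_right

theorem linearMap_eq_sum {V : Type*} [AddCommGroup V] [Module ℝ V] (b : Basis (Fin n) ℝ V)
    (L : V →ₗ[ℝ] ℝ) (w : V) : L w = ∑ j, b.coord j w * L (b j) := by
  conv_lhs => rw [← b.sum_repr w, map_sum]
  simp only [map_smul, smul_eq_mul]
  rfl

theorem IsSmoothFieldOn.mono {X : ∀ y : M, Tan n y} {V : Set M} (hX : IsSmoothFieldOn X U)
    (h : V ⊆ U) : IsSmoothFieldOn X V :=
  ContMDiffOn.mono hX h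

omit [IsManifold (𝓡 n) ∞ M] in
theorem field_eq_sum (f : ∀ y : M, Frame n y) (X : ∀ y : M, Tan n y) :
    X = fun y ↦ ∑ i, (f y).coord i (X y) • f y i := by
  funext y
  exact ((f y).sum_repr (X y)).symm

/-- `(D_v α)(X)` is tensorial in `X`. -/
theorem formCov_eq_sum (hα : FormDiffAt α x) (hU : IsOpen U) (hx : x ∈ U)
    (hf : IsSmoothFrameOn f U) (he : IsSmoothFrameOn e U)
    {X : ∀ y : M, Tan n y} (hX : IsSmoothFieldOn X U) (v : Tan n x) :
    formCov D k α e X x v =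
      ∑ j, (f x).coord j (X x) * formCov D k α e (fun y ↦ f y j) x v := by
  have hF : ∀ j, DiffAt n (fun y ↦ (f y).coord j (X y)) x := fun j ↦
    SmoothAt.diffAt (contMDiffAt_coord (hf.fieldSmoothAt hU hx) (hX.fieldSmoothAt hU hx) j)
  have hαf : ∀ j, DiffAt n (fun y ↦ α y (e y) (f y j)) x := fun j ↦ hα U hU hx e he _ (hf j)
  have h1 : (fun y ↦ α y (e y) (X y)) =
      fun y ↦ ∑ j, (f y).coord j (X y) * α y (e y) (f y j) := by
    funext y
    exact linearMap_eq_sum (f y) _ _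
  have h2 : D X x v = ∑ i, ((f x).coord i (X x) • D (fun y ↦ f y i) x v +
      mvfderiv (𝓡 n) (fun y ↦ (f y).coord i (X y)) x v • f x i) := by
    conv_lhs => rw [field_eq_sum f X]
    rw [conn_sum_smul (fun i ↦ (hf.fieldSmoothAt hU hx i).fieldDiffAt) hF]
  have hd : ∀ j, DiffAt n (fun y ↦ (f y).coord j (X y) * α y (e y) (f y j)) x := fun j ↦
    (hF j).mul (hαf j)
  simp only [formCov, covScalar_apply]
  rw [h1, mvfderiv_sum_apply _ hd, h2, congrFun h1 x, Finset.mul_sum, Finset.sum_mul, map_sum,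
    ← Finset.sum_add_distrib, ← Finset.sum_sub_distrib]
  -- The derivatives of the components of `X` appear once from `v (α(X))` and once, with the
  -- opposite sign, from `α (D_v X)`.
  refine Finset.sum_congr rfl fun j _ ↦ ?_
  rw [mvfderiv_mul_apply (hF j) (hαf j)]
  simp only [map_add, map_smul, smul_eq_mul]
  ring

theorem formCov_change (hw : HasWeight k α) (hα : FormDiffAt α x) (hU : IsOpen U) (hx : x ∈ U)
    (hf : IsSmoothFrameOn f U) (he : IsSmoothFrameOn e U)
    {X : ∀ y : M, Tan n y} (hX : IsSmoothFieldOn X U) (v : Tan n x) :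
    formCov D k α e X x v = |(f x).det (e x)| ^ (-k / (n : ℝ)) * formCov D k α f X x v := by
  have hs : HasWeight (V := fun _ : M ↦ ℝ) k (fun y b ↦ α y b (X y)) := fun y b b' ↦ by
    simp [hw y b b']
  rw [formCov, covScalar_change hs (he.fieldSmoothAt hU hx) (hf.fieldSmoothAt hU hx)
    (hα U hU hx f hf X hX), formCov, hw x (f x) (e x)]
  simp only [LinearMap.smul_apply, smul_eq_mul]
  ring

theorem formCov_change_of_eq (hw : HasWeight k α) (hα : FormDiffAt α x) (hU : IsOpen U)
    (hx : x ∈ U) (hf : IsSmoothFrameOn f U) (he : IsSmoothFrameOn e U)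
    {X : ∀ y : M, Tan n y} (hX : IsSmoothFieldOn X U) (h : e x = f x) (v : Tan n x) :
    formCov D k α e X x v = formCov D k α f X x v := by
  rw [formCov_change hw hα hU hx hf he hX, h, Basis.det_self]
  simp

/-- Replacing `e` by the extension of `e x` changes nothing, since the determinant of the change is
`1` at `x`; tensoriality in `X` then reduces the claim to frame vectors, where it is the definition.
This frees later computations from the extension chosen separately at each point. -/
theorem covForm_apply_eq (hw : HasWeight k α) (hα : FormDiffAt α x) (hU : IsOpen U) (hx : x ∈ U)
    (he : IsSmoothFrameOn e U) {X : ∀ y : M, Tan n y} (hX : IsSmoothFieldOn X U) (v : Tan n x) :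
    covForm D k α x (e x) v (X x) = formCov D k α e X x v := by
  have hV : IsOpen (U ∩ (chartTriv n x).baseSet) := hU.inter (chartTriv n x).open_baseSet
  have hxV : x ∈ U ∩ (chartTriv n x).baseSet := ⟨hx, by simp⟩
  have hf : IsSmoothFrameOn (extendFrame (e x)) (U ∩ (chartTriv n x).baseSet) :=
    (isSmoothFrameOn_extendFrame (e x)).inter_right
  have hX' := IsSmoothFieldOn.mono hX (inter_subset_left (t := (chartTriv n x).baseSet))
  rw [formCov_change_of_eq hw hα hV hxV hf he.inter_left hX' (extendFrame_self _).symm,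
    formCov_eq_sum hα hV hxV hf hf hX', extendFrame_self]
  simp only [covForm, LinearMap.flip_apply, Basis.constr_apply_fintype, LinearMap.sum_apply,
    LinearMap.smul_apply, smul_eq_mul, formCov, covScalar_apply, extendFrame_self]
  refine Finset.sum_congr rfl fun j _ ↦ ?_
  congr 1
  simp only [LinearMap.add_apply, LinearMap.sub_apply, LinearMap.smul_apply, LinearMap.comp_apply,
    smul_eq_mul, connTrace, frameTrace, extendFrame_self, covFrame]
  rfl

theorem covForm_hasWeight (hw : HasWeight k α) (hα : ∀ x, FormDiffAt α x) :
    HasWeight (V := fun x : M ↦ Tan n x →ₗ[ℝ] Tan n x →ₗ[ℝ] ℝ) k (covForm D k α) := by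
  intro x b b'
  ext v w
  have hV : IsOpen (chartTriv n x).baseSet := (chartTriv n x).open_baseSet
  have hx : x ∈ (chartTriv n x).baseSet := by simp
  have h : ∀ b : Frame n x, covForm D k α x b v w =
      formCov D k α (extendFrame b) (FiberBundle.extend (EuclideanSpace ℝ (Fin n)) w) x v := by
    intro b
    rw [← covForm_apply_eq hw (hα x) hV hx (isSmoothFrameOn_extendFrame b)
      (isSmoothFieldOn_extend w), extendFrame_self, FiberBundle.extend_apply_self]
  rw [h b', formCov_change hw (hα x) hV hx (isSmoothFrameOn_extendFrame b)
    (isSmoothFrameOn_extendFrame b') (isSmoothFieldOn_extend w), ← h b, extendFrame_self,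
    extendFrame_self]
  rfl

end FormDerivative

/-! ### The condition `D c = 0` on arbitrary fields -/

section Parallel

variable {c : ConformalStructure n M} {e : ∀ y : M, Frame n y} {x : M} {U : Set M}

theorem ConformalStructure.hasWeight_flip (c : ConformalStructure n M) (Y : ∀ y : M, Tan n y) :
    HasWeight (V := fun x : M ↦ Tan n x →ₗ[ℝ] ℝ) 2 (fun y b ↦ (c.toFun y b).flip (Y y)) := by
  intro y b b'
  ext v
  simp [c.weight y b b']

theorem ConformalStructure.formDiffAt_flip (c : ConformalStructure n M) {Y : ∀ y : M, Tan n y}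
    (hU : IsOpen U) (hx : x ∈ U) (hY : IsSmoothFieldOn Y U) :
    FormDiffAt (fun y b ↦ (c.toFun y b).flip (Y y)) x := fun V hV hxV e he X hX ↦
  SmoothAt.diffAt <| ((c.smooth (U ∩ V) (hU.inter hV) e he.inter_right X Y
    (IsSmoothFieldOn.mono hX inter_subset_right)
    (IsSmoothFieldOn.mono hY inter_subset_left)).contMDiffAt ((hU.inter hV).mem_nhds ⟨hx, hxV⟩))

/-- A Weyl connection satisfies `D c = 0`, in any moving frame and on any vector fields. -/
theorem WeylConnection.covScalar_eq (D : WeylConnection c) (hU : IsOpen U) (hx : x ∈ U)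
    (he : IsSmoothFrameOn e U) {X Y : ∀ y : M, Tan n y} (hX : IsSmoothFieldOn X U)
    (hY : IsSmoothFieldOn Y U) (v : Tan n x) :
    covScalar D.conn 2 (fun y b ↦ c.toFun y b (X y) (Y y)) e x v =
      c.toFun x (e x) (D.conn X x v) (Y x) + c.toFun x (e x) (X x) (D.conn Y x v) := by
  have hV : IsOpen (U ∩ (chartTriv n x).baseSet) := hU.inter (chartTriv n x).open_baseSet
  have hxV : x ∈ U ∩ (chartTriv n x).baseSet := ⟨hx, by simp⟩
  set f := extendFrame (e x) with hfdef
  have hfx : f x = e x := extendFrame_self _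
  have hf : IsSmoothFrameOn f (U ∩ (chartTriv n x).baseSet) :=
    (isSmoothFrameOn_extendFrame (e x)).inter_right
  have hsub : U ∩ (chartTriv n x).baseSet ⊆ U := inter_subset_left
  have hX' := IsSmoothFieldOn.mono hX hsub
  have hY' := IsSmoothFieldOn.mono hY hsub
  -- The hypothesis `D.parallel` covers only members of the extended frame. Tensoriality then
  -- extends it to arbitrary fields, one argument of `c` at a time.
  have hbase : ∀ i j, covScalar D.conn 2 (fun y b ↦ c.toFun y b (f y i) (f y j)) f x v =
      c.toFun x (f x) (D.conn (fun y ↦ f y i) x v) (f x j) +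
        c.toFun x (f x) (f x i) (D.conn (fun y ↦ f y j) x v) := by
    intro i j
    have h := DFunLike.congr_fun (D.parallel x (e x) i j) v
    simp only [covBilin, LinearMap.add_apply, LinearMap.sub_apply, LinearMap.smul_apply,
      LinearMap.comp_apply, smul_eq_mul, connTrace, covFrame, LinearMap.zero_apply,
      LinearMap.flip_apply, sub_eq_zero] at h
    rw [covScalar_apply, hfx, frameTrace]
    simp only [hfx]
    rw [sub_eq_iff_eq_add] at h
    exact (h.trans (add_comm _ _))
  -- With the second argument fixed, `c` is a 1-form of weight `2`, so the results on `formCov`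
  -- apply to it.
  have h1 : ∀ j, ∀ Z : (∀ y : M, Tan n y), IsSmoothFieldOn Z (U ∩ (chartTriv n x).baseSet) →
      covScalar D.conn 2 (fun y b ↦ c.toFun y b (Z y) (f y j)) f x v =
      c.toFun x (f x) (D.conn Z x v) (f x j) +
        c.toFun x (f x) (Z x) (D.conn (fun y ↦ f y j) x v) := by
    intro j Z hZ
    have h := formCov_eq_sum (D := D.conn) (k := 2) (c.formDiffAt_flip hV hxV (hf j)) hV hxV hf hf
      hZ v
    have h2 : ∀ i, formCov D.conn 2 (fun y b ↦ (c.toFun y b).flip (f y j)) f (fun y ↦ f y i) x v =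
        c.toFun x (f x) (f x i) (D.conn (fun y ↦ f y j) x v) := by
      intro i
      have := hbase i j
      simp only [formCov, LinearMap.flip_apply]
      rw [this]
      ring
    have h3 : ∑ i, (f x).coord i (Z x) * c.toFun x (f x) (f x i) (D.conn (fun y ↦ f y j) x v) =
        c.toFun x (f x) (Z x) (D.conn (fun y ↦ f y j) x v) := by
      exact (linearMap_eq_sum (f x) ((c.toFun x (f x)).flip (D.conn (fun y ↦ f y j) x v)) _).symm
    simp only [h2, h3] at h
    simp only [formCov, LinearMap.flip_apply] at h
    linarith
  have h2 := formCov_eq_sum (D := D.conn) (k := 2) (c.formDiffAt_flip hV hxV hY') hV hxV hf hf hX' v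
  have h3 : ∀ i, formCov D.conn 2 (fun y b ↦ (c.toFun y b).flip (Y y)) f (fun y ↦ f y i) x v =
      c.toFun x (f x) (f x i) (D.conn Y x v) := by
    intro i
    have := h1 i Y hY'
    simp only [formCov, LinearMap.flip_apply]
    have hs : (fun y b ↦ c.toFun y b (f y i) (Y y)) = fun y b ↦ c.toFun y b (Y y) (f y i) := by
      funext y b
      exact c.symm y b _ _
    rw [hs, this, c.symm x (f x) (D.conn Y x v), c.symm x (f x) (Y x)]
    ring
  have h4 : ∑ i, (f x).coord i (X x) * c.toFun x (f x) (f x i) (D.conn Y x v) =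
      c.toFun x (f x) (X x) (D.conn Y x v) := by
    exact (linearMap_eq_sum (f x) ((c.toFun x (f x)).flip (D.conn Y x v)) _).symm
  simp only [h3, h4] at h2
  have h5 := formCov_change_of_eq (D := D.conn) (c.hasWeight_flip Y) (c.formDiffAt_flip hV hxV hY')
    hV hxV hf he.inter_left hX' hfx.symm v
  rw [h2] at h5
  simp only [formCov, LinearMap.flip_apply, hfx] at h5
  linarith

end Parallel

/-! ### Linear algebra of the conformal contractions -/

section ContractionAlgebra

variable {c : ConformalStructure n M} {x : M} {b b' : Frame n x}

theorem gramInv_mul_gram (c : ConformalStructure n M) (x : M) (b : Frame n x) :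
    gramInv c x b * (Matrix.of fun i j ↦ c.toFun x b (b i) (b j)) = 1 :=
  Matrix.nonsing_inv_mul _ (by rw [c.normalized]; exact isUnit_one)

theorem gramInv_symm (c : ConformalStructure n M) (x : M) (b : Frame n x) (i j : Fin n) :
    gramInv c x b i j = gramInv c x b j i := by
  have h : (gramInv c x b).transpose = gramInv c x b := by
    rw [gramInv, Matrix.transpose_nonsing_inv]
    congr 1
    ext i j
    simp [c.symm x b (b i) (b j)]
  exact congrFun (congrFun h j) i

/-- The contraction of the inverse Gram matrix with its inverse, in the shape that turns every
double contraction into the trace of an endomorphism. -/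
theorem sum_gramInv_mul (c : ConformalStructure n M) (x : M) (b : Frame n x) (u : Tan n x)
    (i : Fin n) : ∑ j, gramInv c x b i j * c.toFun x b u (b j) = b.coord i u := by
  have h : ∀ j, c.toFun x b u (b j) = ∑ m, b.coord m u * c.toFun x b (b j) (b m) := fun j ↦ by
    rw [c.symm]
    exact linearMap_eq_sum b (c.toFun x b (b j)) u
  simp only [h, Finset.mul_sum]
  rw [Finset.sum_comm]
  have h2 : ∀ m, ∑ j, gramInv c x b i j * (b.coord m u * c.toFun x b (b j) (b m)) =
      b.coord m u * (1 : Matrix (Fin n) (Fin n) ℝ) i m := fun m ↦ by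
    rw [← gramInv_mul_gram c x b, Matrix.mul_apply, Finset.mul_sum]
    refine Finset.sum_congr rfl fun j _ ↦ ?_
    simp only [Matrix.of_apply]
    ring
  simp only [h2, Matrix.one_apply]
  simp

theorem apply_sharp (c : ConformalStructure n M) (x : M) (b : Frame n x) (ξ : Tan n x →ₗ[ℝ] ℝ) :
    c.toFun x b (sharp c x b ξ) = ξ := by
  refine b.ext fun m ↦ ?_
  simp only [sharp, map_sum, map_smul, LinearMap.sum_apply, LinearMap.smul_apply, smul_eq_mul]
  have h : ∀ i, ∑ j, gramInv c x b i j * ξ (b i) * c.toFun x b (b j) (b m) =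
      ξ (b i) * (1 : Matrix (Fin n) (Fin n) ℝ) i m := fun i ↦ by
    rw [← gramInv_mul_gram c x b, Matrix.mul_apply, Finset.mul_sum]
    refine Finset.sum_congr rfl fun j _ ↦ ?_
    simp only [Matrix.of_apply]
    ring
  simp only [h, Matrix.one_apply]
  simp

theorem conformal_injective (c : ConformalStructure n M) (x : M) (b : Frame n x) :
    Function.Injective (c.toFun x b) := by
  refine (injective_iff_map_eq_zero _).2 fun u hu ↦ ?_
  by_contra h
  exact (c.pos x b u h).ne' (by rw [hu]; rfl)

theorem sharp_eq_iff {ξ : Tan n x →ₗ[ℝ] ℝ} {u : Tan n x} :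
    sharp c x b ξ = u ↔ ξ = c.toFun x b u := by
  refine ⟨fun h ↦ by rw [← h, apply_sharp], fun h ↦ conformal_injective c x b ?_⟩
  rw [apply_sharp, h]

theorem innerForm_eq_apply_sharp (ξ η : Tan n x →ₗ[ℝ] ℝ) :
    innerForm c x b ξ η = η (sharp c x b ξ) := by
  simp [innerForm, sharp]

theorem sharp_add (ξ η : Tan n x →ₗ[ℝ] ℝ) :
    sharp c x b (ξ + η) = sharp c x b ξ + sharp c x b η :=
  sharp_eq_iff.2 (by rw [map_add, apply_sharp, apply_sharp])

theorem sharp_smul (r : ℝ) (ξ : Tan n x →ₗ[ℝ] ℝ) :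
    sharp c x b (r • ξ) = r • sharp c x b ξ :=
  sharp_eq_iff.2 (by rw [map_smul, apply_sharp])

variable (c b) in
/-- The endomorphism that corresponds to a bilinear form: `c (T v, w) = P (v, w)`. -/
def endOf (P : Tan n x →ₗ[ℝ] Tan n x →ₗ[ℝ] ℝ) : Tan n x →ₗ[ℝ] Tan n x where
  toFun v := sharp c x b (P v)
  map_add' v w := by rw [map_add, sharp_add]
  map_smul' r v := by rw [map_smul, sharp_smul]; rfl

theorem apply_endOf (P : Tan n x →ₗ[ℝ] Tan n x →ₗ[ℝ] ℝ) (v : Tan n x) :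
    c.toFun x b (endOf c b P v) = P v := apply_sharp c x b (P v)

theorem sum_gramInv_eq_trace (P : Tan n x →ₗ[ℝ] Tan n x →ₗ[ℝ] ℝ) :
    ∑ i, ∑ j, gramInv c x b i j * P (b i) (b j) = LinearMap.trace ℝ _ (endOf c b P) := by
  rw [LinearMap.trace_eq_matrix_trace ℝ b, Matrix.trace]
  refine Finset.sum_congr rfl fun i _ ↦ ?_
  rw [Matrix.diag_apply, LinearMap.toMatrix_apply]
  refine Eq.trans ?_ (sum_gramInv_mul c x b (endOf c b P (b i)) i)
  simp [apply_endOf]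

omit [IsManifold (𝓡 n) ∞ M] in
theorem abs_det_pos (b b' : Frame n x) : 0 < |b.det b'| :=
  abs_pos.2 (b.isUnit_det b').ne_zero

/-- The weight `2` of `c` enters inversely, so `♯` lowers weights by `2`. -/
theorem sharp_change (ξ : Tan n x →ₗ[ℝ] ℝ) :
    sharp c x b' ξ = (|b.det b'| ^ (2 / (n : ℝ))) • sharp c x b ξ := by
  refine sharp_eq_iff.2 ?_
  rw [c.weight x b b']
  simp only [LinearMap.smul_apply, map_smul, smul_smul]
  rw [← Real.rpow_add (abs_det_pos b b'), apply_sharp]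
  simp [neg_div]

/-- Transposition is an isometry, so half of `|P - Pᵗ|²` is `|P|² - ⟨P, Pᵗ⟩`. The surviving `⟨P,
Pᵗ⟩` is the trace of the square of the endomorphism dual to `P`; no symmetry of `P` is needed. -/
theorem innerBilin_sub_half (P : Tan n x →ₗ[ℝ] Tan n x →ₗ[ℝ] ℝ) :
    innerBilin c x b P P - innerTwoForm c x b (P - P.flip) (P - P.flip) =
      LinearMap.trace ℝ _ (endOf c b P ∘ₗ endOf c b P) := by
  have h1 : innerBilin c x b P.flip P.flip = innerBilin c x b P P := by
    simp only [innerBilin, LinearMap.flip_apply]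
    rw [Finset.sum_comm]
    refine Finset.sum_congr rfl fun i _ ↦ Finset.sum_congr rfl fun j _ ↦ ?_
    rw [Finset.sum_comm]
    refine Finset.sum_congr rfl fun p _ ↦ Finset.sum_congr rfl fun q _ ↦ ?_
    ring
  have h2 : innerBilin c x b P.flip P = innerBilin c x b P P.flip := by
    simp only [innerBilin, LinearMap.flip_apply]
    rw [Finset.sum_comm]
    refine Finset.sum_congr rfl fun i _ ↦ Finset.sum_congr rfl fun j _ ↦ ?_
    rw [Finset.sum_comm]
    refine Finset.sum_congr rfl fun p _ ↦ Finset.sum_congr rfl fun q _ ↦ ?_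
    ring
  have h3 : innerBilin c x b (P - P.flip) (P - P.flip) =
      innerBilin c x b P P - innerBilin c x b P P.flip - innerBilin c x b P.flip P +
        innerBilin c x b P.flip P.flip := by
    simp only [innerBilin, ← Finset.sum_add_distrib, ← Finset.sum_sub_distrib]
    refine Finset.sum_congr rfl fun i _ ↦ Finset.sum_congr rfl fun j _ ↦
      Finset.sum_congr rfl fun p _ ↦ Finset.sum_congr rfl fun q _ ↦ ?_
    simp only [LinearMap.sub_apply]
    ring
  have h4 : innerBilin c x b P P.flip = LinearMap.trace ℝ _ (endOf c b P ∘ₗ endOf c b P) := by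
    rw [LinearMap.trace_eq_matrix_trace ℝ b, LinearMap.toMatrix_comp b b b, Matrix.trace]
    simp only [Matrix.diag_apply, Matrix.mul_apply, LinearMap.toMatrix_apply, innerBilin,
      LinearMap.flip_apply]
    refine Finset.sum_congr rfl fun i _ ↦ ?_
    have h5 : ∀ q, b.repr (endOf c b P (b q)) i = ∑ p, gramInv c x b i p * P (b q) (b p) :=
      fun q ↦ by
        refine (sum_gramInv_mul c x b (endOf c b P (b q)) i).symm.trans ?_
        simp [apply_endOf]
    have h6 : ∀ q, b.repr (endOf c b P (b i)) q = ∑ j, gramInv c x b j q * P (b i) (b j) :=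
      fun q ↦ by
        refine (sum_gramInv_mul c x b (endOf c b P (b i)) q).symm.trans ?_
        simp [apply_endOf, gramInv_symm c x b q]
    simp only [h5, h6, Finset.sum_mul_sum]
    have : ∀ j, ∑ p, ∑ q, gramInv c x b i p * gramInv c x b j q * P (b i) (b j) * P (b q) (b p) =
        ∑ q, ∑ p, gramInv c x b i p * gramInv c x b j q * P (b i) (b j) * P (b q) (b p) :=
      fun j ↦ Finset.sum_comm
    simp only [this]
    rw [Finset.sum_comm]
    refine Finset.sum_congr rfl fun q _ ↦ ?_
    rw [Finset.sum_comm]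
    refine Finset.sum_congr rfl fun p _ ↦ Finset.sum_congr rfl fun j _ ↦ ?_
    ring
  rw [innerTwoForm, h3, h1, h2, ← h4]
  ring

end ContractionAlgebra

/-! ### The integrand and `ζ_α` in terms of `T = D (α^♯)`, and their weights -/

section PointwiseForms

variable {c : ConformalStructure n M} (D : WeylConnection c) (k : ℝ)
  (α : ∀ x : M, Frame n x → (Tan n x →ₗ[ℝ] ℝ)) {x : M} {b b' : Frame n x}

theorem codiff_eq_trace (x : M) (b : Frame n x) : codiff D k α x b =
    -LinearMap.trace ℝ _ (endOf c b (covForm D.conn k α x b)) := by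
  rw [codiff, sum_gramInv_eq_trace]

/-- In `D_v α - v ⌟ d^D α` the term `D_v α` cancels and the transposed term remains; pairing it with
`α` evaluates `D α` in the direction `α^♯`. -/
theorem zeta_apply (x : M) (b : Frame n x) (v : Tan n x) : zeta D k α x b v =
    covForm D.conn k α x b (sharp c x b (α x b)) v + codiff D k α x b * α x b v := by
  change innerForm c x b (α x b) _ = _
  rw [innerForm_eq_apply_sharp]
  simp only [extDeriv, LinearMap.sub_apply, LinearMap.add_apply, LinearMap.smul_apply,
    LinearMap.flip_apply, smul_eq_mul]
  rw [c.symm x b v, apply_sharp]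
  ring

theorem sharp_zeta (x : M) (b : Frame n x) : sharp c x b (zeta D k α x b) =
    endOf c b (covForm D.conn k α x b) (sharp c x b (α x b)) -
      LinearMap.trace ℝ _ (endOf c b (covForm D.conn k α x b)) • sharp c x b (α x b) := by
  refine sharp_eq_iff.2 (LinearMap.ext fun v ↦ ?_)
  rw [zeta_apply, map_sub, map_smul, apply_endOf, apply_sharp, codiff_eq_trace]
  simp only [LinearMap.sub_apply, LinearMap.smul_apply, smul_eq_mul]
  ring

theorem bochnerDensity_eq (x : M) (b : Frame n x) : bochnerDensity D k α x b =
    LinearMap.trace ℝ _ (endOf c b (covForm D.conn k α x b) ∘ₗ endOf c b (covForm D.conn k α x b)) -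
      LinearMap.trace ℝ _ (endOf c b (covForm D.conn k α x b)) ^ 2 +
      ricci D.conn x b (sharp c x b (α x b)) (sharp c x b (α x b)) := by
  rw [bochnerDensity, diracNormSq, covNormSq, ← innerBilin_sub_half, ricciSharp, dirac,
    codiff_eq_trace, extDeriv]
  ring

variable {α k}

theorem sharp_form_change (hw : HasWeight k α) (x : M) (b b' : Frame n x) :
    sharp c x b' (α x b') = (|b.det b'| ^ (-(k - 2) / (n : ℝ))) • sharp c x b (α x b) := by
  rw [sharp_change (b := b), hw x b b', sharp_smul, smul_smul,
    ← Real.rpow_add (abs_det_pos b b')]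
  congr 2
  ring

theorem codiff_hasWeight (hw : HasWeight k α) (hα : ∀ x, FormDiffAt α x) :
    HasWeight (V := fun _ : M ↦ ℝ) (k - 2) (codiff D k α) := by
  intro x b b'
  have h : endOf c b' (covForm D.conn k α x b') =
      (|b.det b'| ^ (-(k - 2) / (n : ℝ))) • endOf c b (covForm D.conn k α x b) := by
    ext1 v
    change sharp c x b' (covForm D.conn k α x b' v) =
      (|b.det b'| ^ (-(k - 2) / (n : ℝ))) • sharp c x b (covForm D.conn k α x b v)
    rw [sharp_change (b := b), covForm_hasWeight hw hα x b b', LinearMap.smul_apply, sharp_smul,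
      smul_smul, ← Real.rpow_add (abs_det_pos b b')]
    congr 2
    ring
  rw [codiff_eq_trace, codiff_eq_trace, h, map_smul, smul_neg]

theorem zeta_hasWeight (hw : HasWeight k α) (hα : ∀ x, FormDiffAt α x) :
    HasWeight (V := fun x : M ↦ Tan n x →ₗ[ℝ] ℝ) (2 * k - 2) (zeta D k α) := by
  intro x b b'
  ext v
  rw [LinearMap.smul_apply, zeta_apply, zeta_apply, codiff_hasWeight D hw hα x b b',
    sharp_form_change hw x b b', covForm_hasWeight hw hα x b b', hw x b b', map_smul]
  simp only [LinearMap.smul_apply, smul_eq_mul]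
  have h : |b.det b'| ^ (-(2 * k - 2) / (n : ℝ)) =
      |b.det b'| ^ (-(k - 2) / (n : ℝ)) * |b.det b'| ^ (-k / (n : ℝ)) := by
    rw [← Real.rpow_add (abs_det_pos b b')]
    congr 1
    ring
  rw [h]
  ring

end PointwiseForms

/-! ### Smoothness of the contractions, of `D α` and of `ζ_α` -/

section Smoothness

theorem WeightedOneForm.formDiffAt {k : ℝ} (α : WeightedOneForm n M k) (x : M) :
    FormDiffAt α.toFun x := fun U hU hx e he X hX ↦
  SmoothAt.diffAt ((α.smooth U hU e he X hX).contMDiffAt (hU.mem_nhds hx))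

variable {c : ConformalStructure n M} {e : ∀ y : M, Frame n y} {U : Set M} {x : M}

theorem smoothAt_gramInv (c : ConformalStructure n M) (hU : IsOpen U) (hx : x ∈ U)
    (he : IsSmoothFrameOn e U) (i j : Fin n) : SmoothAt n (fun y ↦ gramInv c y (e y) i j) x := by
  have hg : ∀ i j, SmoothAt n (fun y ↦ c.toFun y (e y) (e y i) (e y j)) x := fun i j ↦
    (c.smooth U hU e he _ _ (he i) (he j)).contMDiffAt (hU.mem_nhds hx)
  -- The normalization makes the Gram determinant `1`, so the inverse is the adjugate and each entry
  -- is a determinant with smooth entries.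
  have h : (fun y ↦ gramInv c y (e y) i j) = fun y ↦
      (Matrix.of fun p q ↦ if p = j then (if q = i then (1 : ℝ) else 0)
        else c.toFun y (e y) (e y p) (e y q)).det := by
    funext y
    rw [gramInv, Matrix.inv_def, c.normalized, Ring.inverse_one, one_smul, Matrix.adjugate_apply]
    congr 1
    ext p q
    by_cases hp : p = j
    · subst hp
      simp [Pi.single_apply]
    · simp [Matrix.updateRow_apply, hp]
  rw [h]
  refine contMDiffAt_det (A := fun p q y ↦ if p = j then (if q = i then (1 : ℝ) else 0)
        else c.toFun y (e y) (e y p) (e y q)) fun p q ↦ ?_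
  by_cases hp : p = j
  · simpa [hp] using contMDiffAt_const
  · simpa [hp] using hg p q

omit [IsManifold (𝓡 n) ∞ M] in
theorem smoothAt_mul {F G : M → ℝ} (hF : SmoothAt n F x) (hG : SmoothAt n G x) :
    SmoothAt n (fun y ↦ F y * G y) x := ContMDiffAt.mul hF hG

omit [IsManifold (𝓡 n) ∞ M] in
theorem smoothAt_add {F G : M → ℝ} (hF : SmoothAt n F x) (hG : SmoothAt n G x) :
    SmoothAt n (fun y ↦ F y + G y) x := ContMDiffAt.add hF hG

omit [IsManifold (𝓡 n) ∞ M] in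
theorem smoothAt_sub {F G : M → ℝ} (hF : SmoothAt n F x) (hG : SmoothAt n G x) :
    SmoothAt n (fun y ↦ F y - G y) x := ContMDiffAt.sub hF hG

omit [IsManifold (𝓡 n) ∞ M] in
theorem smoothAt_sum {ι : Type*} {s : Finset ι} {F : ι → M → ℝ} (hF : ∀ i, SmoothAt n (F i) x) :
    SmoothAt n (fun y ↦ ∑ i ∈ s, F i y) x := contMDiffAt_finsetSum fun i _ ↦ hF i

theorem isSmoothFieldOn_sharp {k : ℝ} (c : ConformalStructure n M) (α : WeightedOneForm n M k)
    (hU : IsOpen U) (he : IsSmoothFrameOn e U) :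
    IsSmoothFieldOn (fun y ↦ sharp c y (e y) (α.toFun y (e y))) U := by
  have h : (fun y ↦ sharp c y (e y) (α.toFun y (e y))) = fun y ↦
      ∑ j, (∑ i, gramInv c y (e y) i j * α.toFun y (e y) (e y i)) • e y j := by
    funext y
    rw [sharp, Finset.sum_comm]
    exact Finset.sum_congr rfl fun j _ ↦ (Finset.sum_smul ..).symm
  rw [h]
  exact he.sum_smul fun j y hy ↦ (smoothAt_sum fun i ↦ smoothAt_mul
    (smoothAt_gramInv c hU hy he i j)
    ((α.smooth U hU e he _ (he i)).contMDiffAt (hU.mem_nhds hy))).contMDiffWithinAt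

variable [T2Space M]

theorem WeylConnection.isSmoothFieldOn_conn (D : WeylConnection c) (hU : IsOpen U)
    {X Y : ∀ y : M, Tan n y} (hX : IsSmoothFieldOn X U) (hY : IsSmoothFieldOn Y U) :
    IsSmoothFieldOn (fun y ↦ D.conn X y (Y y)) U := fun _ hy ↦
  (fieldSmoothAt_conn D.smooth hU hX hy (hY.fieldSmoothAt hU hy)).contMDiffWithinAt

theorem smoothAt_frameTrace (D : WeylConnection c) (hU : IsOpen U) (hx : x ∈ U)
    (he : IsSmoothFrameOn e U) {Y : ∀ y : M, Tan n y} (hY : IsSmoothFieldOn Y U) :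
    SmoothAt n (fun y ↦ frameTrace D.conn e y (Y y)) x := by
  simp only [frameTrace_apply]
  exact smoothAt_sum fun i ↦ contMDiffAt_coord (he.fieldSmoothAt hU hx)
    ((D.isSmoothFieldOn_conn hU (he i) hY).fieldSmoothAt hU hx) i

theorem smoothAt_covForm (D : WeylConnection c) {k : ℝ} (α : WeightedOneForm n M k)
    (hU : IsOpen U) (hx : x ∈ U) (he : IsSmoothFrameOn e U) {X Y : ∀ y : M, Tan n y}
    (hX : IsSmoothFieldOn X U) (hY : IsSmoothFieldOn Y U) :
    SmoothAt n (fun y ↦ covForm D.conn k α.toFun y (e y) (Y y) (X y)) x := by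
  have hα : ∀ Z, IsSmoothFieldOn Z U → SmoothAt n (fun y ↦ α.toFun y (e y) (Z y)) x :=
    fun Z hZ ↦ (α.smooth U hU e he Z hZ).contMDiffAt (hU.mem_nhds hx)
  have h : (fun y ↦ mvfderiv (𝓡 n) (fun z ↦ α.toFun z (e z) (X z)) y (Y y) +
      k / (n : ℝ) * α.toFun y (e y) (X y) * frameTrace D.conn e y (Y y) -
      α.toFun y (e y) (D.conn X y (Y y))) =ᶠ[𝓝 x]
      fun y ↦ covForm D.conn k α.toFun y (e y) (Y y) (X y) := by
    filter_upwards [hU.mem_nhds hx] with y hy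
    rw [covForm_apply_eq α.weight (α.formDiffAt y) hU hy he hX, formCov, covScalar_apply]
  refine ContMDiffAt.congr_of_eventuallyEq ?_ h.symm
  exact smoothAt_sub (smoothAt_add (contMDiffAt_mvfderiv (hα X hX) (hY.fieldSmoothAt hU hx))
    (smoothAt_mul (smoothAt_mul contMDiffAt_const (hα X hX)) (smoothAt_frameTrace D hU hx he hY)))
    (hα _ (D.isSmoothFieldOn_conn hU hX hY))

theorem smoothAt_codiff (D : WeylConnection c) {k : ℝ} (α : WeightedOneForm n M k)
    (hU : IsOpen U) (hx : x ∈ U) (he : IsSmoothFrameOn e U) :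
    SmoothAt n (fun y ↦ codiff D k α.toFun y (e y)) x :=
  ContMDiffAt.neg (smoothAt_sum fun i ↦ smoothAt_sum fun j ↦ smoothAt_mul
    (smoothAt_gramInv c hU hx he i j) (smoothAt_covForm D α hU hx he (he j) (he i)))

/-- `ζ_α` as a `1`-form of weight `2 k - 2`. -/
def zetaForm (D : WeylConnection c) {k : ℝ} (α : WeightedOneForm n M k) :
    WeightedOneForm n M (2 * k - 2) where
  toFun := zeta D k α.toFun
  weight := zeta_hasWeight D α.weight α.formDiffAt
  smooth U hU e he X hX y hy := by
    simp only [zeta_apply]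
    exact (smoothAt_add
      (smoothAt_covForm D α hU hy he hX (isSmoothFieldOn_sharp c α hU he))
      (smoothAt_mul (smoothAt_codiff D α hU hy he)
        ((α.smooth U hU e he X hX).contMDiffAt (hU.mem_nhds hy)))).contMDiffWithinAt

end Smoothness

/-! ### Duality between `D α` and `D (α^♯)` -/

section SharpDerivative

variable {c : ConformalStructure n M} {e : ∀ y : M, Frame n y} {U : Set M} {x : M}

/-- In a moving frame, `D α` is dual to the covariant derivative of the vector field `α^♯` of weight
`k - 2`. -/
theorem covForm_eq_apply_conn_sharp (D : WeylConnection c) {k : ℝ} (α : WeightedOneForm n M k)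
    (hU : IsOpen U) (hx : x ∈ U) (he : IsSmoothFrameOn e U) (v : Tan n x) :
    covForm D.conn k α.toFun x (e x) v = c.toFun x (e x)
      (D.conn (fun y ↦ sharp c y (e y) (α.toFun y (e y))) x v +
        ((k - 2) / (n : ℝ) * frameTrace D.conn e x v) • sharp c x (e x) (α.toFun x (e x))) := by
  have hA := isSmoothFieldOn_sharp c α hU he
  refine (e x).ext fun j ↦ ?_
  rw [covForm_apply_eq α.weight (α.formDiffAt x) hU hx he (he j), formCov]
  -- Here `D c = 0` is used, on `α(e_j) = c (α^♯, e_j)`. The weight term `2/n` from `c` is what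
  -- turns the coefficient `k/n` into `(k - 2)/n`.
  have h1 := D.covScalar_eq hU hx he hA (he j) v
  rw [covScalar_apply] at h1 ⊢
  have h2 : (fun y ↦ c.toFun y (e y) (sharp c y (e y) (α.toFun y (e y))) (e y j)) =
      fun y ↦ α.toFun y (e y) (e y j) := by
    funext y
    rw [apply_sharp]
  simp only [apply_sharp] at h1
  rw [map_add, map_smul, apply_sharp]
  simp only [LinearMap.add_apply, LinearMap.smul_apply, smul_eq_mul]
  rw [sub_div]
  linarith

end SharpDerivative

/-! ### The underlying identity of finite sums -/

section Algebra

/-- The identity between the derivatives at a point of the components of a vector field `a` of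
weight `n r` and of the Christoffel symbols `G` of a torsion-free connection that underlies the
conformal Bochner formula. Here `da`, `dd`, `dG` stand for the first and second derivatives of `a`
and the first derivatives of `G`. -/
theorem divergence_algebra (r : ℝ) (a t : Fin n → ℝ) (da h dt : Fin n → Fin n → ℝ)
    (G dd dh : Fin n → Fin n → Fin n → ℝ) (dG : Fin n → Fin n → Fin n → Fin n → ℝ)
    (hG : ∀ i l m, G i l m = G l i m) (hdd : ∀ j i m, dd j i m = dd i j m)
    (ht : ∀ i, t i = ∑ l, G i l l)
    (hh : ∀ i m, h i m = da i m + ∑ l, a l * G i l m + r * (t i * a m))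
    (hdh : ∀ j i m, dh j i m = dd j i m + ∑ l, (a l * dG j i l m + da j l * G i l m) +
      r * (t i * da j m + dt j i * a m)) :
    ∑ m, ((∑ i, (a i * dh m i m + da m i * h i m) -
        ((∑ i, h i i) * da m m + (∑ i, dh m i i) * a m)) +
        ∑ l, (∑ i, a i * h i l - (∑ i, h i i) * a l) * G m l m) +
        2 * r * ∑ m, t m * (∑ i, a i * h i m - (∑ i, h i i) * a m) =
      ∑ i, ∑ j, h i j * h j i - (∑ i, h i i) ^ 2 +
        ∑ i, ((∑ j, a j * ∑ l, a l * dG i j l i + ∑ s, (∑ j, a j * ∑ l, a l * G j l s) * G i s i) -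
          ∑ j, a j * (∑ l, a l * dG j i l i + ∑ s, (∑ l, a l * G i l s) * G j s i)) := by
  -- `N` is the Christoffel part of `h`. With it `da` is eliminated in favour of `h`, so that both
  -- sides become polynomials in a few named contractions.
  obtain ⟨N, hN⟩ : ∃ N : Fin n → Fin n → ℝ, ∀ i m, ∑ l, a l * G i l m = N i m :=
    ⟨_, fun _ _ ↦ rfl⟩
  have hN' : ∀ i m, ∑ l, a l * G l i m = N i m := fun i m ↦ by
    rw [← hN]
    exact Finset.sum_congr rfl fun l _ ↦ by rw [hG]
  have ht' : ∀ i, ∑ m, G m i m = t i := fun i ↦ by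
    rw [ht]
    exact Finset.sum_congr rfl fun l _ ↦ by rw [hG]
  have hda : ∀ i m, da i m = h i m - N i m - r * (t i * a m) := fun i m ↦ by
    rw [hh, hN]
    ring
  set T := ∑ i, h i i with hT
  set HH := ∑ i, ∑ j, h i j * h j i with hHH
  set NH := ∑ i, ∑ j, N i j * h j i with hNH
  set NN := ∑ i, ∑ j, N i j * N j i with hNN
  set ta := ∑ i, t i * a i with hta
  set tah := ∑ i, ∑ m, a i * h i m * t m with htah
  set taN := ∑ i, ∑ m, a i * N i m * t m with htaN
  set D1 := ∑ m, ∑ i, a i * ∑ l, a l * dG m i l m with hD1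
  set D2 := ∑ m, ∑ i, a m * ∑ l, a l * dG m i l i with hD2
  set E := ∑ m, ∑ i, a i * a m * dt m i with hE
  set P := ∑ m, ∑ i, a m * dd m i i with hP
  have e1 : ∑ m, ∑ i, da m i * h i m = HH - NH - r * tah := by
    have : ∑ m, ∑ i, t m * a i * h i m = tah := by
      rw [Finset.sum_comm]
      exact Finset.sum_congr rfl fun i _ ↦ Finset.sum_congr rfl fun m _ ↦ by ring
    rw [← this, hHH, hNH, Finset.mul_sum]
    simp only [Finset.mul_sum, ← Finset.sum_sub_distrib]
    exact Finset.sum_congr rfl fun i _ ↦ Finset.sum_congr rfl fun m _ ↦ by rw [hda]; ring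
  have e2' : ∑ m, N m m = ta := by
    simp only [← hN]
    rw [Finset.sum_comm]
    refine Finset.sum_congr rfl fun l _ ↦ ?_
    rw [← Finset.mul_sum, ht', mul_comm]
  have e2 : ∑ m, da m m = T - (1 + r) * ta := by
    have : ∑ m, da m m = T - ∑ m, N m m - r * ta := by
      rw [hT, hta, Finset.mul_sum]
      simp only [← Finset.sum_sub_distrib]
      exact Finset.sum_congr rfl fun i _ ↦ by rw [hda]
    rw [this, e2']
    ring
  have e3' : ∑ m, t m * (∑ i, a i * h i m - T * a m) = tah - T * ta := by
    rw [htah, Finset.sum_comm, hta, Finset.mul_sum, ← Finset.sum_sub_distrib]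
    refine Finset.sum_congr rfl fun m _ ↦ ?_
    rw [← Finset.sum_mul]
    ring
  have e3 : ∑ m, ∑ l, (∑ i, a i * h i l - T * a l) * G m l m = tah - T * ta := by
    rw [Finset.sum_comm, ← e3']
    refine Finset.sum_congr rfl fun m _ ↦ ?_
    rw [← Finset.mul_sum, ht', mul_comm]
  have eQ : ∑ m, ∑ i, a i * ∑ l, da m l * G i l m = NH - NN - r * taN := by
    have h1 : ∀ m, ∑ i, a i * ∑ l, da m l * G i l m = ∑ l, da m l * N l m := fun m ↦ by
      simp only [← hN', Finset.mul_sum]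
      rw [Finset.sum_comm]
      exact Finset.sum_congr rfl fun i _ ↦ Finset.sum_congr rfl fun l _ ↦ by ring
    have h2 : ∑ m, ∑ l, h m l * N l m = NH := by
      rw [Finset.sum_comm]
      exact Finset.sum_congr rfl fun i _ ↦ Finset.sum_congr rfl fun l _ ↦ by ring
    have h3 : ∑ m, ∑ l, t m * a l * N l m = taN := by
      rw [Finset.sum_comm]
      exact Finset.sum_congr rfl fun i _ ↦ Finset.sum_congr rfl fun l _ ↦ by ring
    simp only [h1]
    rw [← h2, ← h3, hNN, Finset.mul_sum]
    simp only [Finset.mul_sum, ← Finset.sum_sub_distrib]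
    exact Finset.sum_congr rfl fun i _ ↦ Finset.sum_congr rfl fun m _ ↦ by rw [hda]; ring
  have eR : ∑ m, ∑ i, a m * t i * da m i = tah - taN - r * ta ^ 2 := by
    have h1 : ta ^ 2 = ∑ m, ∑ i, (t m * a m) * (t i * a i) := by
      rw [sq, hta, Finset.sum_mul_sum]
    rw [h1, htah, htaN, Finset.mul_sum]
    simp only [Finset.mul_sum, ← Finset.sum_sub_distrib]
    exact Finset.sum_congr rfl fun i _ ↦ Finset.sum_congr rfl fun m _ ↦ by rw [hda]; ring
  have eR' : ∑ m, ∑ i, a m * ∑ l, da m l * G i l i = ∑ m, ∑ i, a m * t i * da m i := by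
    refine Finset.sum_congr rfl fun m _ ↦ ?_
    simp only [Finset.mul_sum]
    rw [Finset.sum_comm]
    refine Finset.sum_congr rfl fun l _ ↦ ?_
    rw [← ht', Finset.mul_sum, Finset.sum_mul]
    exact Finset.sum_congr rfl fun i _ ↦ by ring
  -- The two contractions of `dh` carry the second derivatives. Their parts `P` agree by the
  -- symmetry `hdd`; their parts `E`, which contain the derivatives of `t`, agree because `a i * a
  -- m` is symmetric. Hence the curvature of the weight drops out.
  have e4 : ∑ m, ∑ i, a i * dh m i m =
      P + D1 + (NH - NN - r * taN) + r * (ta * (T - (1 + r) * ta) + E) := by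
    have h1 : ∑ m, ∑ i, a i * dd m i m = P := by
      rw [Finset.sum_comm]
      exact Finset.sum_congr rfl fun i _ ↦ Finset.sum_congr rfl fun m _ ↦ by rw [hdd]
    have h2 : ta * (T - (1 + r) * ta) = ∑ m, ∑ i, (a i * t i) * da m m := by
      rw [← e2, hta, mul_comm, Finset.sum_mul_sum]
      exact Finset.sum_congr rfl fun i _ ↦ Finset.sum_congr rfl fun m _ ↦ by ring
    rw [← h1, ← eQ, h2, hD1, hE]
    simp only [mul_add, Finset.mul_sum, ← Finset.sum_add_distrib]
    refine Finset.sum_congr rfl fun m _ ↦ Finset.sum_congr rfl fun i _ ↦ ?_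
    rw [hdh]
    simp only [Finset.sum_add_distrib, mul_add, Finset.mul_sum]
    ring
  have e5 : ∑ m, ∑ i, dh m i i * a m =
      P + D2 + (1 + r) * (tah - taN - r * ta ^ 2) + r * E := by
    rw [add_mul, one_mul, ← eR]
    nth_rewrite 1 [← eR']
    rw [hP, hD2, hE]
    simp only [Finset.mul_sum, ← Finset.sum_add_distrib]
    refine Finset.sum_congr rfl fun m _ ↦ Finset.sum_congr rfl fun i _ ↦ ?_
    rw [hdh]
    simp only [Finset.sum_add_distrib, mul_add, add_mul, Finset.sum_mul]
    simp only [mul_comm, mul_left_comm]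
    ring
  -- The Ricci term: derivative parts `D1 - D2`, quadratic parts `taN - NN`.
  have e6 : ∑ i, ((∑ j, a j * ∑ l, a l * dG i j l i +
      ∑ s, (∑ j, a j * ∑ l, a l * G j l s) * G i s i) -
      ∑ j, a j * (∑ l, a l * dG j i l i + ∑ s, (∑ l, a l * G i l s) * G j s i)) =
      D1 + taN - D2 - NN := by
    have h1 : ∑ i, ∑ s, (∑ j, a j * ∑ l, a l * G j l s) * G i s i = taN := by
      have h0 : taN = ∑ m, ∑ i, a i * N i m * t m := Finset.sum_comm
      rw [h0, Finset.sum_comm]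
      refine Finset.sum_congr rfl fun s _ ↦ ?_
      rw [← Finset.mul_sum, ht', Finset.sum_mul]
      exact Finset.sum_congr rfl fun j _ ↦ by rw [hN]
    have h2 : ∑ i, ∑ j, a j * ∑ s, (∑ l, a l * G i l s) * G j s i = NN := by
      refine Finset.sum_congr rfl fun i _ ↦ ?_
      simp only [hN, Finset.mul_sum]
      rw [Finset.sum_comm]
      refine Finset.sum_congr rfl fun s _ ↦ ?_
      rw [← hN' s i, Finset.mul_sum]
      exact Finset.sum_congr rfl fun j _ ↦ by ring
    have h3 : ∑ i, ∑ j, a j * ∑ l, a l * dG j i l i = D2 := Finset.sum_comm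
    simp only [mul_add, Finset.sum_add_distrib, Finset.sum_sub_distrib]
    rw [h1, h2, h3]
    ring
  have e7 : ∑ m, (∑ i, dh m i i) * a m = ∑ m, ∑ i, dh m i i * a m :=
    Finset.sum_congr rfl fun m _ ↦ Finset.sum_mul ..
  simp only [Finset.sum_add_distrib, Finset.sum_sub_distrib, ← Finset.mul_sum] at e6 ⊢
  -- After `P`, `E` and `NH` cancel, the terms `tah`, `T * ta` and `ta ^ 2` vanish because the
  -- coefficient in front of the last sum is `2 * r`, twice that of `a`. What is left is `HH - T ^ 2
  -- + D1 + taN - D2 - NN`.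
  rw [e6, e1, e2, e3, e3', e4, e7, e5]
  ring

end Algebra

/-! ### Christoffel symbols and curvature in the extended frame -/

section Christoffel

/-- The Christoffel symbols of a connection in a moving frame:
`D_{e_i} e_l = ∑ m, christoffel D e i l m • e_m`. -/
def christoffel (D : CovariantDerivative (𝓡 n) (EuclideanSpace ℝ (Fin n)) (Tan n : M → Type))
    (e : ∀ y : M, Frame n y) (i l m : Fin n) (y : M) : ℝ :=
  (e y).coord m (D (fun z ↦ e z l) y (e y i))

variable {D : CovariantDerivative (𝓡 n) (EuclideanSpace ℝ (Fin n)) (Tan n : M → Type)}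
  {e : ∀ y : M, Frame n y} {U : Set M} {x : M}

theorem frameTrace_frame (D : CovariantDerivative (𝓡 n) (EuclideanSpace ℝ (Fin n)) (Tan n : M → Type))
    (e : ∀ y : M, Frame n y) (x : M) (i : Fin n) :
    frameTrace D e x (e x i) = ∑ l, christoffel D e i l l x :=
  frameTrace_apply D e x (e x i)

theorem coord_conn (hU : IsOpen U) (hx : x ∈ U) (he : IsSmoothFrameOn e U)
    {X : ∀ y : M, Tan n y} (hX : IsSmoothFieldOn X U) (i m : Fin n) :
    (e x).coord m (D X x (e x i)) = mvfderiv (𝓡 n) (fun y ↦ (e y).coord m (X y)) x (e x i) +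
      ∑ l, (e x).coord l (X x) * christoffel D e i l m x := by
  have hF : ∀ j, DiffAt n (fun y ↦ (e y).coord j (X y)) x := fun j ↦
    SmoothAt.diffAt (contMDiffAt_coord (he.fieldSmoothAt hU hx) (hX.fieldSmoothAt hU hx) j)
  have h : D X x (e x i) = ∑ l, ((e x).coord l (X x) • D (fun y ↦ e y l) x (e x i) +
      mvfderiv (𝓡 n) (fun y ↦ (e y).coord l (X y)) x (e x i) • e x l) := by
    conv_lhs => rw [field_eq_sum e X]
    rw [conn_sum_smul (fun i ↦ (he.fieldSmoothAt hU hx i).fieldDiffAt) hF]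
  rw [h, map_sum]
  simp only [map_add, map_smul, smul_eq_mul, Finset.sum_add_distrib]
  rw [add_comm]
  congr 1
  simp [Finsupp.single_apply]

theorem smoothAt_christoffel [T2Space M] {c : ConformalStructure n M} (D : WeylConnection c)
    (hU : IsOpen U) (hx : x ∈ U) (he : IsSmoothFrameOn e U) (i l m : Fin n) :
    SmoothAt n (christoffel D.conn e i l m) x :=
  contMDiffAt_coord (he.fieldSmoothAt hU hx)
    ((D.isSmoothFieldOn_conn hU (he l) (he i)).fieldSmoothAt hU hx) m

/-- Torsion-freeness, together with the vanishing bracket of the extended vectors. Symmetry at the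
centre `x` suffices, since `divergence_algebra` never exchanges the lower indices of a
differentiated symbol. -/
theorem christoffel_extendFrame_symm {c : ConformalStructure n M} (D : WeylConnection c)
    (b : Frame n x) (i l m : Fin n) :
    christoffel D.conn (extendFrame b) i l m x = christoffel D.conn (extendFrame b) l i m x := by
  have hb : IsOpen (chartTriv n x).baseSet := (chartTriv n x).open_baseSet
  have hx : x ∈ (chartTriv n x).baseSet := by simp
  have hd : ∀ v : Tan n x, FieldDiffAt (FiberBundle.extend (EuclideanSpace ℝ (Fin n)) v) x :=
    fun v ↦ ((isSmoothFieldOn_extend v).fieldSmoothAt hb hx).fieldDiffAt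
  have hc : ∀ l, D.conn (fun y ↦ extendFrame b y l) x =
      D.conn (FiberBundle.extend (EuclideanSpace ℝ (Fin n)) (b l)) x := fun l ↦ by
    refine conn_congr ((isSmoothFrameOn_extendFrame b).fieldSmoothAt hb hx l).fieldDiffAt (hd _) ?_
    filter_upwards [hb.mem_nhds hx] with y hy
    exact extendFrame_apply b hy l
  have h := (CovariantDerivative.torsion_eq_zero_iff D.conn).1 D.torsionFree (hd (b i)) (hd (b l))
  rw [mlieBracket_extend, FiberBundle.extend_apply_self, FiberBundle.extend_apply_self,
    sub_eq_zero] at h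
  simp only [christoffel, hc, extendFrame_self, h]

theorem extend_eq_sum (b : Frame n x) (v : Tan n x) {y : M} (hy : y ∈ (chartTriv n x).baseSet) :
    FiberBundle.extend (EuclideanSpace ℝ (Fin n)) v y = ∑ j, b.coord j v • extendFrame b y j := by
  have hx : x ∈ (chartTriv n x).baseSet := by simp
  have h : ∀ w : Tan n x, FiberBundle.extend (EuclideanSpace ℝ (Fin n)) w y =
      ((chartTriv n x).linearEquivAt ℝ y hy).symm ((chartTriv n x).linearEquivAt ℝ x hx w) := by
    intro w
    apply ((chartTriv n x).linearEquivAt ℝ y hy).injective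
    simpa [Trivialization.apply_mk_symm _ hy] using chartTriv_extend n w hy
  simp only [extendFrame_apply b hy]
  rw [h]
  conv_lhs => rw [← b.sum_repr v]
  simp only [map_sum, map_smul, ← h]
  rfl

variable {c : ConformalStructure n M} (D : WeylConnection c)

/-- The extension of `v` has constant components in the extended frame, so only the Christoffel term
of `coord_conn` remains. -/
theorem coord_conn_extend (b : Frame n x) (v : Tan n x) {y : M}
    (hy : y ∈ (chartTriv n x).baseSet) (i m : Fin n) :
    (extendFrame b y).coord m
      (D.conn (FiberBundle.extend (EuclideanSpace ℝ (Fin n)) v) y (extendFrame b y i)) =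
      ∑ l, b.coord l v * christoffel D.conn (extendFrame b) i l m y := by
  have hb : IsOpen (chartTriv n x).baseSet := (chartTriv n x).open_baseSet
  have hcoord : ∀ z ∈ (chartTriv n x).baseSet, ∀ l,
      (extendFrame b z).coord l (FiberBundle.extend (EuclideanSpace ℝ (Fin n)) v z) =
        b.coord l v := by
    intro z hz l
    rw [extend_eq_sum b v hz]
    simp [Finsupp.single_apply]
  rw [coord_conn hb hy (isSmoothFrameOn_extendFrame b) (isSmoothFieldOn_extend v),
    mvfderiv_congr (G := fun _ ↦ b.coord m v), mvfderiv_const_apply, zero_add]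
  · exact Finset.sum_congr rfl fun l _ ↦ by rw [hcoord y hy]
  · filter_upwards [hb.mem_nhds hy] with z hz
    exact hcoord z hz m

variable [T2Space M]

/-- The components of the curvature in terms of Christoffel symbols. -/
theorem coord_curvature (b : Frame n x) (v : Tan n x) (i m : Fin n) :
    b.coord m (curvature D.conn x (b i) v v) =
      (∑ j, b.coord j v * ∑ l, b.coord l v *
          mvfderiv (𝓡 n) (christoffel D.conn (extendFrame b) j l m) x (b i) +
        ∑ s, (∑ j, b.coord j v * ∑ l, b.coord l v * christoffel D.conn (extendFrame b) j l s x) *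
          christoffel D.conn (extendFrame b) i s m x) -
      ∑ j, b.coord j v * (∑ l, b.coord l v *
          mvfderiv (𝓡 n) (christoffel D.conn (extendFrame b) i l m) x (b j) +
        ∑ s, (∑ l, b.coord l v * christoffel D.conn (extendFrame b) i l s x) *
          christoffel D.conn (extendFrame b) j s m x) := by
  have hb : IsOpen (chartTriv n x).baseSet := (chartTriv n x).open_baseSet
  have hx : x ∈ (chartTriv n x).baseSet := by simp
  set e := extendFrame b with he_def
  have hex : e x = b := extendFrame_self b
  have he : IsSmoothFrameOn e (chartTriv n x).baseSet := isSmoothFrameOn_extendFrame b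
  have hG : ∀ i l m, DiffAt n (christoffel D.conn e i l m) x := fun i l m ↦
    SmoothAt.diffAt (smoothAt_christoffel D hb hx he i l m)
  have hGs : ∀ i m, DiffAt n (fun y ↦ ∑ l, b.coord l v * christoffel D.conn e i l m y) x :=
    fun i m ↦ DiffAt.sum _ fun l ↦ MDifferentiableAt.mul
      (p := fun _ ↦ b.coord l v) mdifferentiableAt_const (hG i l m)
  have hGd : ∀ i m w, mvfderiv (𝓡 n) (fun y ↦ ∑ l, b.coord l v * christoffel D.conn e i l m y) x w =
      ∑ l, b.coord l v * mvfderiv (𝓡 n) (christoffel D.conn e i l m) x w := fun i m w ↦ by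
    have hd : ∀ l, DiffAt n (fun y ↦ b.coord l v * christoffel D.conn e i l m y) x := fun l ↦
      MDifferentiableAt.mul (p := fun _ ↦ b.coord l v) mdifferentiableAt_const (hG i l m)
    rw [mvfderiv_sum_apply _ hd]
    exact Finset.sum_congr rfl fun l _ ↦ mvfderiv_const_mul_apply (hG i l m) _ _
  set W := (FiberBundle.extend (EuclideanSpace ℝ (Fin n)) v : ∀ y : M, Tan n y) with hW
  have hWs : IsSmoothFieldOn W (chartTriv n x).baseSet := isSmoothFieldOn_extend v
  -- `h1` and `h2` are the two second derivatives in the curvature. The inner derivative has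
  -- explicit components on the whole base set, so it can be differentiated once more.
  have h1 : b.coord m (D.conn (fun y ↦ D.conn W y (W y)) x (b i)) =
      ∑ j, b.coord j v * ∑ l, b.coord l v *
          mvfderiv (𝓡 n) (christoffel D.conn e j l m) x (b i) +
        ∑ s, (∑ j, b.coord j v * ∑ l, b.coord l v * christoffel D.conn e j l s x) *
          christoffel D.conn e i s m x := by
    have hY := D.isSmoothFieldOn_conn hb hWs hWs
    have hYc : ∀ y ∈ (chartTriv n x).baseSet, ∀ m, (e y).coord m (D.conn W y (W y)) =
        ∑ j, b.coord j v * ∑ l, b.coord l v * christoffel D.conn e j l m y := by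
      intro y hy m
      conv_lhs => rw [hW, extend_eq_sum b v hy, ← hW]
      simp only [map_sum, map_smul, smul_eq_mul]
      exact Finset.sum_congr rfl fun j _ ↦ by rw [hW, he_def, coord_conn_extend D b v hy]
    have h := coord_conn (D := D.conn) hb hx he hY i m
    rw [hex] at h
    rw [h, mvfderiv_congr (G := fun y ↦ ∑ j, b.coord j v *
      ∑ l, b.coord l v * christoffel D.conn e j l m y)]
    · congr 1
      · have hd : ∀ j, DiffAt n (fun y ↦ b.coord j v *
            ∑ l, b.coord l v * christoffel D.conn e j l m y) x := fun j ↦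
          MDifferentiableAt.mul (p := fun _ ↦ b.coord j v) mdifferentiableAt_const (hGs j m)
        rw [mvfderiv_sum_apply _ hd]
        exact Finset.sum_congr rfl fun j _ ↦ by rw [mvfderiv_const_mul_apply (hGs j m), hGd]
      · refine Finset.sum_congr rfl fun s _ ↦ ?_
        have := hYc x hx s
        rw [hex] at this
        rw [this]
    · filter_upwards [hb.mem_nhds hx] with y hy
      exact hYc y hy m
  have h2 : ∀ j, b.coord m (D.conn (fun y ↦ D.conn W y
      (FiberBundle.extend (EuclideanSpace ℝ (Fin n)) (b i) y)) x (b j)) =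
      ∑ l, b.coord l v * mvfderiv (𝓡 n) (christoffel D.conn e i l m) x (b j) +
        ∑ s, (∑ l, b.coord l v * christoffel D.conn e i l s x) *
          christoffel D.conn e j s m x := by
    intro j
    have hY := D.isSmoothFieldOn_conn hb hWs (isSmoothFieldOn_extend (b i))
    have hYc : ∀ y ∈ (chartTriv n x).baseSet, ∀ m, (e y).coord m (D.conn W y
        (FiberBundle.extend (EuclideanSpace ℝ (Fin n)) (b i) y)) =
        ∑ l, b.coord l v * christoffel D.conn e i l m y := by
      intro y hy m
      rw [← extendFrame_apply b hy, hW, he_def, coord_conn_extend D b v hy]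
    have h := coord_conn (D := D.conn) hb hx he hY j m
    rw [hex] at h
    rw [h, mvfderiv_congr (G := fun y ↦ ∑ l, b.coord l v * christoffel D.conn e i l m y)]
    · rw [hGd]
      congr 1
      refine Finset.sum_congr rfl fun s _ ↦ ?_
      have := hYc x hx s
      rw [hex] at this
      rw [this]
    · filter_upwards [hb.mem_nhds hx] with y hy
      exact hYc y hy m
  have h3 : b.coord m (D.conn (fun y ↦ D.conn W y
      (FiberBundle.extend (EuclideanSpace ℝ (Fin n)) (b i) y)) x v) =
      ∑ j, b.coord j v * b.coord m (D.conn (fun y ↦ D.conn W y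
        (FiberBundle.extend (EuclideanSpace ℝ (Fin n)) (b i) y)) x (b j)) :=
    linearMap_eq_sum b (b.coord m ∘ₗ (D.conn (fun y ↦ D.conn W y
      (FiberBundle.extend (EuclideanSpace ℝ (Fin n)) (b i) y)) x).toLinearMap) v
  simp only [curvature]
  rw [mlieBracket_extend, map_zero, sub_zero, map_sub, h1, h3]
  simp only [h2]

end Christoffel

/-! ### The pointwise conformal Bochner identity -/

section PointwiseIdentity

omit [IsManifold (𝓡 n) ∞ M] in
theorem trace_eq_sum_coord {x : M} (b : Frame n x) (T : Tan n x →ₗ[ℝ] Tan n x) :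
    LinearMap.trace ℝ _ T = ∑ i, b.coord i (T (b i)) := by
  rw [LinearMap.trace_eq_matrix_trace ℝ b, Matrix.trace]
  exact Finset.sum_congr rfl fun i _ ↦ by rw [Matrix.diag_apply, LinearMap.toMatrix_apply]; rfl

omit [IsManifold (𝓡 n) ∞ M] in
theorem trace_comp_self_eq_sum_coord {x : M} (b : Frame n x) (T : Tan n x →ₗ[ℝ] Tan n x) :
    LinearMap.trace ℝ _ (T ∘ₗ T) = ∑ i, ∑ j, b.coord j (T (b i)) * b.coord i (T (b j)) := by
  rw [trace_eq_sum_coord b]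
  exact Finset.sum_congr rfl fun i _ ↦ linearMap_eq_sum b (b.coord i ∘ₗ T) (T (b i))

variable {c : ConformalStructure n M} {e : ∀ y : M, Frame n y} {U : Set M} {x : M} {k : ℝ}

/-- The components in a moving frame of the vector field `α^♯` of weight `k - 2`. -/
def sharpCoord (c : ConformalStructure n M) (α : ∀ x : M, Frame n x → (Tan n x →ₗ[ℝ] ℝ))
    (e : ∀ y : M, Frame n y) (l : Fin n) (y : M) : ℝ :=
  (e y).coord l (sharp c y (e y) (α y (e y)))

theorem smoothAt_sharpCoord (c : ConformalStructure n M) (α : WeightedOneForm n M k)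
    (hU : IsOpen U) (hx : x ∈ U) (he : IsSmoothFrameOn e U) (l : Fin n) :
    SmoothAt n (sharpCoord c α.toFun e l) x :=
  contMDiffAt_coord (he.fieldSmoothAt hU hx)
    ((isSmoothFieldOn_sharp c α hU he).fieldSmoothAt hU hx) l

/-- The components of `D (α^♯)` in a moving frame. -/
def covCoord (D : WeylConnection c) (k : ℝ) (α : ∀ x : M, Frame n x → (Tan n x →ₗ[ℝ] ℝ))
    (e : ∀ y : M, Frame n y) (i m : Fin n) (y : M) : ℝ :=
  mvfderiv (𝓡 n) (sharpCoord c α e m) y (e y i) +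
    ∑ l, sharpCoord c α e l y * christoffel D.conn e i l m y +
    (k - 2) / (n : ℝ) * ((∑ l, christoffel D.conn e i l l y) * sharpCoord c α e m y)

theorem coord_endOf_covForm (D : WeylConnection c) (α : WeightedOneForm n M k)
    (hU : IsOpen U) (hx : x ∈ U) (he : IsSmoothFrameOn e U) (i m : Fin n) :
    (e x).coord m (endOf c (e x) (covForm D.conn k α.toFun x (e x)) (e x i)) =
      covCoord D k α.toFun e i m x := by
  have h : endOf c (e x) (covForm D.conn k α.toFun x (e x)) (e x i) =
      D.conn (fun y ↦ sharp c y (e y) (α.toFun y (e y))) x (e x i) +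
        ((k - 2) / (n : ℝ) * frameTrace D.conn e x (e x i)) •
          sharp c x (e x) (α.toFun x (e x)) :=
    sharp_eq_iff.2 (covForm_eq_apply_conn_sharp D α hU hx he (e x i))
  rw [h, map_add, map_smul, coord_conn hU hx he (isSmoothFieldOn_sharp c α hU he),
    frameTrace_frame, smul_eq_mul, mul_assoc]
  rfl

/-- The formula `ζ_α^♯ = T A - (tr T) A` in components. It holds at every point of `U` in one frame,
so it may be differentiated. -/
theorem sharpCoord_zeta (D : WeylConnection c) (α : WeightedOneForm n M k)
    (hU : IsOpen U) (hx : x ∈ U) (he : IsSmoothFrameOn e U) (m : Fin n) :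
    sharpCoord c (zeta D k α.toFun) e m x =
      ∑ i, sharpCoord c α.toFun e i x * covCoord D k α.toFun e i m x -
        (∑ i, covCoord D k α.toFun e i i x) * sharpCoord c α.toFun e m x := by
  rw [sharpCoord, sharp_zeta, map_sub, map_smul, smul_eq_mul, trace_eq_sum_coord (e x)]
  congr 1
  · refine (linearMap_eq_sum (e x) ((e x).coord m ∘ₗ
      endOf c (e x) (covForm D.conn k α.toFun x (e x))) _).trans ?_
    exact Finset.sum_congr rfl fun i _ ↦ by
      rw [LinearMap.comp_apply, coord_endOf_covForm D α hU hx he]; rfl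
  · simp only [coord_endOf_covForm D α hU hx he]
    rfl

theorem codiff_eq_sum_covCoord (D : WeylConnection c) (α : WeightedOneForm n M k)
    (hU : IsOpen U) (hx : x ∈ U) (he : IsSmoothFrameOn e U) :
    codiff D k α.toFun x (e x) = -∑ i, covCoord D k α.toFun e i i x := by
  rw [codiff_eq_trace, trace_eq_sum_coord (e x)]
  simp only [coord_endOf_covForm D α hU hx he]

variable [T2Space M]

/-- The conformal Bochner formula holds pointwise, with a divergence as remainder. -/
theorem bochnerDensity_eq_neg_codiff (D : WeylConnection c) (α : WeightedOneForm n M k)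
    (x : M) (b : Frame n x) :
    bochnerDensity D k α.toFun x b = -codiff D (2 * k - 2) (zeta D k α.toFun) x b := by
  have hU : IsOpen (chartTriv n x).baseSet := (chartTriv n x).open_baseSet
  have hx : x ∈ (chartTriv n x).baseSet := by simp
  set e := extendFrame b with he_def
  have hex : e x = b := extendFrame_self b
  have he : IsSmoothFrameOn e (chartTriv n x).baseSet := isSmoothFrameOn_extendFrame b
  set a := sharpCoord c α.toFun e with ha_def
  set G := christoffel D.conn e with hG_def
  set h := covCoord D k α.toFun e with hh_def
  set r := (k - 2) / (n : ℝ) with hr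
  have haS : ∀ l, SmoothAt n (a l) x := fun l ↦ smoothAt_sharpCoord c α hU hx he l
  have hGS : ∀ i l m, SmoothAt n (G i l m) x := fun i l m ↦ smoothAt_christoffel D hU hx he i l m
  have hdaS : ∀ i m, SmoothAt n (fun y ↦ mvfderiv (𝓡 n) (a m) y (e y i)) x := fun i m ↦
    contMDiffAt_mvfderiv (haS m) (he.fieldSmoothAt hU hx i)
  have ha : ∀ l, DiffAt n (a l) x := fun l ↦ (haS l).diffAt
  have hG : ∀ i l m, DiffAt n (G i l m) x := fun i l m ↦ (hGS i l m).diffAt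
  have haG : ∀ i m l, DiffAt n (fun y ↦ a l y * G i l m y) x := fun i m l ↦
    (smoothAt_mul (haS l) (hGS i l m)).diffAt
  have hts : ∀ i, SmoothAt n (fun y ↦ ∑ l, G i l l y) x := fun i ↦ smoothAt_sum fun l ↦ hGS i l l
  have hta : ∀ i m, SmoothAt n (fun y ↦ (∑ l, G i l l y) * a m y) x := fun i m ↦
    smoothAt_mul (hts i) (haS m)
  have hrt : ∀ i m, SmoothAt n (fun y ↦ r * ((∑ l, G i l l y) * a m y)) x := fun i m ↦
    smoothAt_mul contMDiffAt_const (hta i m)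
  have hs2 : ∀ i m, SmoothAt n
      (fun y ↦ mvfderiv (𝓡 n) (a m) y (e y i) + ∑ l, a l y * G i l m y) x := fun i m ↦
    smoothAt_add (hdaS i m) (smoothAt_sum fun l ↦ smoothAt_mul (haS l) (hGS i l m))
  have hhS : ∀ i m, SmoothAt n (h i m) x := fun i m ↦ smoothAt_add (hs2 i m) (hrt i m)
  have hh : ∀ i m, DiffAt n (h i m) x := fun i m ↦ (hhS i m).diffAt
  have hdh : ∀ j i m, mvfderiv (𝓡 n) (h i m) x (b j) =
      mvfderiv (𝓡 n) (fun y ↦ mvfderiv (𝓡 n) (a m) y (e y i)) x (b j) +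
        ∑ l, (a l x * mvfderiv (𝓡 n) (G i l m) x (b j) +
          mvfderiv (𝓡 n) (a l) x (b j) * G i l m x) +
        r * ((∑ l, G i l l x) * mvfderiv (𝓡 n) (a m) x (b j) +
          mvfderiv (𝓡 n) (fun y ↦ ∑ l, G i l l y) x (b j) * a m x) := by
    intro j i m
    change mvfderiv (𝓡 n) (fun y ↦ (mvfderiv (𝓡 n) (a m) y (e y i) + ∑ l, a l y * G i l m y) +
      r * ((∑ l, G i l l y) * a m y)) x (b j) = _
    rw [mvfderiv_add_apply (hs2 i m).diffAt (hrt i m).diffAt,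
      mvfderiv_add_apply (hdaS i m).diffAt (DiffAt.sum _ (haG i m)),
      mvfderiv_sum_apply _ (haG i m), mvfderiv_const_mul_apply (hta i m).diffAt,
      mvfderiv_mul_apply (hts i).diffAt (ha m)]
    congr 2
    exact Finset.sum_congr rfl fun l _ ↦ mvfderiv_mul_apply (ha l) (hG i l m) _
  -- The frame is constant in the chart at `x`, so this is the symmetry of the second derivative.
  have hdd : ∀ j i m, mvfderiv (𝓡 n) (fun y ↦ mvfderiv (𝓡 n) (a m) y (e y i)) x (b j) =
      mvfderiv (𝓡 n) (fun y ↦ mvfderiv (𝓡 n) (a m) y (e y j)) x (b i) := by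
    have hE : ∀ i m, mvfderiv (𝓡 n) (fun y ↦ mvfderiv (𝓡 n) (a m) y (e y i)) x =
        mvfderiv (𝓡 n) (fun y ↦ mvfderiv (𝓡 n) (a m) y
          (FiberBundle.extend (EuclideanSpace ℝ (Fin n)) (b i) y)) x := fun i m ↦ by
      refine mvfderiv_congr ?_
      filter_upwards [hU.mem_nhds hx] with y hy
      rw [he_def, extendFrame_apply b hy]
    intro j i m
    rw [hE, hE]
    exact mvfderiv_mvfderiv_extend_comm (haS m) (b i) (b j)
  have hz : ∀ m, mvfderiv (𝓡 n) (sharpCoord c (zeta D k α.toFun) e m) x (b m) =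
      ∑ i, (a i x * mvfderiv (𝓡 n) (h i m) x (b m) + mvfderiv (𝓡 n) (a i) x (b m) * h i m x) -
        ((∑ i, h i i x) * mvfderiv (𝓡 n) (a m) x (b m) +
          (∑ i, mvfderiv (𝓡 n) (h i i) x (b m)) * a m x) := by
    intro m
    have hah : ∀ i, DiffAt n (fun y ↦ a i y * h i m y) x := fun i ↦
      (smoothAt_mul (haS i) (hhS i m)).diffAt
    have hhs : SmoothAt n (fun y ↦ ∑ i, h i i y) x := smoothAt_sum fun i ↦ hhS i i
    rw [mvfderiv_congr (G := fun y ↦ ∑ i, a i y * h i m y - (∑ i, h i i y) * a m y),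
      mvfderiv_sub_apply (DiffAt.sum _ hah) (smoothAt_mul hhs (haS m)).diffAt,
      mvfderiv_sum_apply _ hah, mvfderiv_mul_apply hhs.diffAt (ha m),
      mvfderiv_sum_apply _ fun i ↦ hh i i]
    · congr 1
      exact Finset.sum_congr rfl fun i _ ↦ mvfderiv_mul_apply (ha i) (hh i m) _
    · filter_upwards [hU.mem_nhds hx] with y hy
      exact sharpCoord_zeta D α hU hy he m
  have key := divergence_algebra r (fun l ↦ a l x) (fun i ↦ ∑ l, G i l l x)
    (fun i m ↦ mvfderiv (𝓡 n) (a m) x (b i)) (fun i m ↦ h i m x)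
    (fun j i ↦ mvfderiv (𝓡 n) (fun y ↦ ∑ l, G i l l y) x (b j)) (fun i l m ↦ G i l m x)
    (fun j i m ↦ mvfderiv (𝓡 n) (fun y ↦ mvfderiv (𝓡 n) (a m) y (e y i)) x (b j))
    (fun j i m ↦ mvfderiv (𝓡 n) (h i m) x (b j))
    (fun j i l m ↦ mvfderiv (𝓡 n) (G i l m) x (b j))
    (fun i l m ↦ christoffel_extendFrame_symm D b i l m) hdd (fun _ ↦ rfl)
    (fun i m ↦ by rw [← hex]; rfl) hdh
  have hcodiff : codiff D (2 * k - 2) (zeta D k α.toFun) x b =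
      -∑ m, (mvfderiv (𝓡 n) (sharpCoord c (zeta D k α.toFun) e m) x (b m) +
        ∑ l, (∑ i, a i x * h i l x - (∑ i, h i i x) * a l x) * G m l m x +
        2 * r * ((∑ l, G m l l x) * (∑ i, a i x * h i m x - (∑ i, h i i x) * a m x))) := by
    have h1 := codiff_eq_sum_covCoord D (zetaForm D α) hU hx he
    rw [hex] at h1
    refine h1.trans (congrArg Neg.neg (Finset.sum_congr rfl fun m _ ↦ ?_))
    change covCoord D (2 * k - 2) (zeta D k α.toFun) e m m x = _
    rw [covCoord, hex]
    simp only [sharpCoord_zeta D α hU hx he]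
    -- `ζ_α^♯` has weight `2 k - 4`, twice that of `α^♯`: the coefficient that `divergence_algebra`
    -- requires.
    rw [show (2 * k - 2 - 2) / (n : ℝ) = 2 * r by rw [hr]; ring]
  have hric : ricci D.conn x b (sharp c x b (α.toFun x b)) (sharp c x b (α.toFun x b)) =
      ∑ i, ((∑ j, a j x * ∑ l, a l x * mvfderiv (𝓡 n) (G j l i) x (b i) +
          ∑ s, (∑ j, a j x * ∑ l, a l x * G j l s x) * G i s i x) -
        ∑ j, a j x * (∑ l, a l x * mvfderiv (𝓡 n) (G i l i) x (b j) +
          ∑ s, (∑ l, a l x * G i l s x) * G j s i x)) := by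
    have hca : ∀ l, b.coord l (sharp c x b (α.toFun x b)) = a l x := fun l ↦ by
      rw [ha_def, sharpCoord, hex]
    rw [ricci]
    refine Finset.sum_congr rfl fun i _ ↦ ?_
    rw [coord_curvature]
    simp only [hca]
    rfl
  have hT : ∀ i m, b.coord m (endOf c b (covForm D.conn k α.toFun x b) (b i)) = h i m x :=
    fun i m ↦ by
      have := coord_endOf_covForm D α hU hx he i m
      rwa [hex] at this
  rw [bochnerDensity_eq, hcodiff, neg_neg, hric, trace_comp_self_eq_sum_coord b,
    trace_eq_sum_coord b]
  simp only [hT, hz]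
  rw [← key, Finset.mul_sum _ _ (2 * r), ← Finset.sum_add_distrib]

end PointwiseIdentity

/-! ### Integrability on compact sets -/

section Integrability

/-- In the coordinates of a chart, a density is evaluated in the extension of the coordinate frame
at the centre of the chart. -/
theorem coordDensity_eq (s : ∀ x : M, Frame n x → ℝ) (p : M) {y : M}
    (hy : y ∈ (chartTriv n p).baseSet) :
    coordDensity s p y = s y (extendFrame ((chartTriv n p).basisAt
      (EuclideanSpace.basisFun (Fin n) ℝ).toBasis (by simp : p ∈ (chartTriv n p).baseSet)) y) := by
  rw [coordDensity, dif_pos hy]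
  congr 1
  refine Basis.eq_of_apply_eq fun i ↦ ?_
  rw [extendFrame_apply _ hy]
  apply ((chartTriv n p).linearEquivAt ℝ y hy).injective
  have hp : p ∈ (chartTriv n p).baseSet := by simp
  refine Eq.trans ?_ (chartTriv_extend n _ hy).symm
  refine Eq.trans ?_ (((chartTriv n p).linearEquivAt ℝ p hp).apply_symm_apply _).symm
  exact ((chartTriv n p).linearEquivAt ℝ y hy).apply_symm_apply _

theorem coordDensity_neg (s : ∀ x : M, Frame n x → ℝ) (p y : M) :
    coordDensity (fun x b ↦ -s x b) p y = -coordDensity s p y := by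
  rw [coordDensity, coordDensity]
  split_ifs <;> simp

variable [T2Space M] {c : ConformalStructure n M} {k : ℝ}

theorem continuousOn_coordDensity_codiff (D : WeylConnection c) (α : WeightedOneForm n M k)
    (p : M) : ContinuousOn (coordDensity (codiff D k α.toFun) p)
      (chartAt (EuclideanSpace ℝ (Fin n)) p).source := by
  have hU : IsOpen (chartTriv n p).baseSet := (chartTriv n p).open_baseSet
  rw [← TangentBundle.trivializationAt_baseSet (I := 𝓡 n)]
  refine ContinuousOn.congr (fun y hy ↦ ?_) fun y hy ↦ coordDensity_eq _ p hy
  exact (smoothAt_codiff D α hU hy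
    (isSmoothFrameOn_extendFrame _)).continuousAt.continuousWithinAt

omit [IsManifold (𝓡 n) ∞ M] [T2Space M] in
theorem measurableSet_chartImage {Ω : Set M} (hΩ : IsClosed Ω) (p : M) :
    MeasurableSet (chartImage (n := n) Ω p) := by
  set φ := chartAt (EuclideanSpace ℝ (Fin n)) p
  have h : chartImage (n := n) Ω p = φ.target \ (φ.target ∩ φ.symm ⁻¹' Ωᶜ) := by
    rw [chartImage, inter_comm, φ.image_source_inter_eq']
    ext u
    simp
  rw [h]
  exact φ.open_target.measurableSet.diff
    (φ.isOpen_inter_preimage_symm hΩ.isOpen_compl).measurableSet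

variable [SigmaCompactSpace M]

theorem tsupport_chartPartition_subset (p : M) :
    tsupport (chartPartition n M p) ⊆ (chartAt (EuclideanSpace ℝ (Fin n)) p).source :=
  (SmoothPartitionOfUnity.exists_isSubordinate_chartAt_source (𝓡 n) M).choose_spec p

/-- On `Ω` the term of index `p` vanishes off the support of the partition function. The part of `Ω`
in that support is compact and lies in the chart domain, where the term is continuous. -/
theorem densityIntegrableOn_of_continuousOn {s : ∀ x : M, Frame n x → ℝ}
    (hs : ∀ p, ContinuousOn (coordDensity s p) (chartAt (EuclideanSpace ℝ (Fin n)) p).source)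
    {Ω : Set M} (hΩ : IsCompact Ω) : DensityIntegrableOn s Ω := by
  intro p
  set φ := chartAt (EuclideanSpace ℝ (Fin n)) p with hφ
  have hK : IsCompact (φ '' (Ω ∩ tsupport (chartPartition n M p))) :=
    (hΩ.inter_right (isClosed_tsupport _)).image_of_continuousOn
      (φ.continuousOn.mono (inter_subset_right.trans (tsupport_chartPartition_subset p)))
  have hKt : φ '' (Ω ∩ tsupport (chartPartition n M p)) ⊆ φ.target := by
    rintro _ ⟨y, hy, rfl⟩
    exact φ.map_source (tsupport_chartPartition_subset p hy.2)
  have hc : ContinuousOn (localDensity s p) φ.target :=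
    ((chartPartition n M p).contMDiff.continuous.comp_continuousOn φ.continuousOn_symm).mul
      ((hs p).comp φ.continuousOn_symm φ.mapsTo_symm)
  refine ((hc.mono hKt).integrableOn_compact hK).of_forall_sdiff_eq_zero
    (measurableSet_chartImage hΩ.isClosed p) ?_
  rintro _ ⟨⟨y, hy, rfl⟩, hyK⟩
  have h0 : chartPartition n M p y = 0 :=
    image_eq_zero_of_notMem_tsupport fun hyt ↦ hyK ⟨y, ⟨hy.1, hyt⟩, rfl⟩
  rw [localDensity, ← hφ, φ.left_inv hy.2, h0, zero_mul]

theorem localDensity_neg (s : ∀ x : M, Frame n x → ℝ) (p : M) :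
    localDensity (fun x b ↦ -s x b) p = fun u ↦ -localDensity s p u := by
  funext u
  rw [localDensity, localDensity, coordDensity_neg, mul_neg]

theorem DensityIntegrableOn.neg {s : ∀ x : M, Frame n x → ℝ} {Ω : Set M}
    (hs : DensityIntegrableOn s Ω) : DensityIntegrableOn (fun x b ↦ -s x b) Ω := fun p ↦ by
  rw [localDensity_neg]
  exact (hs p).neg

theorem densityIntegral_neg (s : ∀ x : M, Frame n x → ℝ) (Ω : Set M) :
    densityIntegral (fun x b ↦ -s x b) Ω = -densityIntegral s Ω := by
  simp only [densityIntegral, localDensity_neg, integral_neg]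
  exact finsum_neg_distrib _

end Integrability

end ConformalWeyl

end

theorem mainTheorem4 (n : ℕ) (M : Type*) [TopologicalSpace M] [T2Space M] [SigmaCompactSpace M]
    [ChartedSpace (EuclideanSpace ℝ (Fin n)) M] [IsManifold (𝓡 n) ∞ M]
    (c : ConformalWeyl.ConformalStructure n M) (D : ConformalWeyl.WeylConnection c)
    (k : ℝ) (hk : k = (4 - (n : ℝ)) / 2) (α : ConformalWeyl.WeightedOneForm n M k)
    (Ω : Set M) (hΩ : IsCompact Ω) :
    ∃ ζ : ConformalWeyl.WeightedOneForm n M (2 * k - 2),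
      ζ.toFun = ConformalWeyl.zeta D k α.toFun ∧
      ConformalWeyl.HasWeight (-(n : ℝ)) (ConformalWeyl.bochnerDensity D k α.toFun) ∧
      ConformalWeyl.HasWeight (-(n : ℝ)) (ConformalWeyl.codiff D (2 * k - 2) ζ.toFun) ∧
      ConformalWeyl.DensityIntegrableOn (ConformalWeyl.bochnerDensity D k α.toFun) Ω ∧
      ConformalWeyl.DensityIntegrableOn (ConformalWeyl.codiff D (2 * k - 2) ζ.toFun) Ω ∧
      ConformalWeyl.densityIntegral (ConformalWeyl.bochnerDensity D k α.toFun) Ω =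
        -ConformalWeyl.densityIntegral (ConformalWeyl.codiff D (2 * k - 2) ζ.toFun) Ω := by
  have hB : ConformalWeyl.bochnerDensity D k α.toFun = fun x b ↦
      -ConformalWeyl.codiff D (2 * k - 2) (ConformalWeyl.zetaForm D α).toFun x b :=
    funext fun x ↦ funext fun b ↦ ConformalWeyl.bochnerDensity_eq_neg_codiff D α x b
  have hw : ConformalWeyl.HasWeight (V := fun _ : M ↦ ℝ) (-(n : ℝ))
      (ConformalWeyl.codiff D (2 * k - 2) (ConformalWeyl.zetaForm D α).toFun) := by
    have h := ConformalWeyl.codiff_hasWeight D (ConformalWeyl.zetaForm D α).weight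
      (ConformalWeyl.zetaForm D α).formDiffAt
    -- The only use of the value of `k`: the divergence becomes a density of the weight that can be
    -- integrated.
    rwa [show 2 * k - 2 - 2 = -(n : ℝ) by rw [hk]; ring] at h
  have hi := ConformalWeyl.densityIntegrableOn_of_continuousOn
    (ConformalWeyl.continuousOn_coordDensity_codiff D (ConformalWeyl.zetaForm D α)) hΩ
  refine ⟨ConformalWeyl.zetaForm D α, rfl, ?_, hw, ?_, hi, ?_⟩
  · rw [hB]
    intro x b b'
    exact (congrArg Neg.neg (hw x b b')).trans (smul_neg _ _).symm
  · rw [hB]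
    exact hi.neg
  · rw [hB, ConformalWeyl.densityIntegral_neg]
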